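/- Let $\mathrm{Nil}$ be the group of real matrices $\begin{pmatrix}1&x&z\\0&1&y\\0&0&1\end{pmatrix}$ with the left-invariant metric $ds^2=dx^2+dy^2+(dz-x\,dy)^2$, and let $e_1,e_2,e_3$ be the orthonormal basis of its Lie algebra that equals $\partial_x,\partial_y,\partial_z$ at the unit. Let $M$ be a closed oriented surface smoothly immersed in $\mathrm{Nil}$ by $f$, regarded as a compact Riemann surface with the conformal structure of the induced metric; that is, $M$ is a compact Riemann surface and $f:M\to\mathrm{Nil}$ is a smooth conformal immersion. In a conformal parameter $z=x+iy$ the induced metric is $e^{2\alpha}\,dz\,d\bar z$ and the induced area measure is $d\mu=e^{2\alpha}\,dx\,dy$. Write $f^{-1}\partial f=\sum_k Z_ke_k$ with $\partial=\frac12(\partial_x-i\partial_y)$. A smooth function $\psi=(\psi_1,\psi_2)$ such that $$Z_1=\tfrac i2(\bar\psi_2^2+\psi_1^2),\qquad Z_2=\tfrac12(\bar\psi_2^2-\psi_1^2),\qquad Z_3=\psi_1\bar\psi_2$$ is called a generating spinor, and continuous functions $U,V$ such that $$\partial\psi_2+U\psi_1=0,\qquad -\bar\partial\psi_1+V\psi_2=0$$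 are called its potentials. Generating spinors and potentials exist locally around every point of $M$, and the energy $$E(M)=\int_M UV\,dx\wedge dy$$ is well defined, i.e. $M$ can be cut into finitely many disjoint Borel pieces, each lying in the domain of a conformal parameter with a generating spinor and potentials, the integral converges absolutely on each piece, and the sum of the integrals over the pieces does not depend on the choice of the pieces, the parameters, the spinors and the potentials. Moreover $$E(M)=\frac14\int_M\Big(H^2+\frac{\widehat K}{4}-\frac1{16}\Big)\,d\mu,$$ where the integrand on the right is integrable, $H$ is the mean curvature of the surface (half the trace of the second fundamental form) and $\widehat K$ is the sectional curvature of $\mathrm{Nil}$ along the tangent plane of the surface. In particular $E(M)$ is real. -/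

import Mathlib

open MeasureTheory
open scoped Manifold ContDiff Matrix

noncomputable section

/-! ## The group Nil with its left-invariant metric -/

/-- The group `Nil` of real matrices `!![1, x, z; 0, 1, y; 0, 0, 1]`. -/
def Nil : Subgroup (Matrix.SpecialLinearGroup (Fin 3) ℝ) where
  carrier := {A | ∃ x y z : ℝ,
    (A : Matrix (Fin 3) (Fin 3) ℝ) = !![1, x, z; 0, 1, y; 0, 0, 1]}
  one_mem' := ⟨0, 0, 0, by ext i j; fin_cases i <;> fin_cases j <;> simp⟩
  mul_mem' := by
    rintro A B ⟨x, y, z, hA⟩ ⟨x', y', z', hB⟩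
    refine ⟨x + x', y + y', z' + x * y' + z, ?_⟩
    rw [Matrix.SpecialLinearGroup.coe_mul, hA, hB]
    ext i j
    fin_cases i <;> fin_cases j <;> simp [Matrix.mul_apply, Fin.sum_univ_three, add_comm]
  inv_mem' := by
    rintro A ⟨x, y, z, hA⟩
    refine ⟨-x, -y, x * y - z, ?_⟩
    rw [Matrix.SpecialLinearGroup.coe_inv, hA, Matrix.adjugate_fin_three]
    ext i j
    fin_cases i <;> fin_cases j <;> simp

namespace Nil

/-- The basis `e₁, e₂, e₃` of the Lie algebra of `Nil`. -/
def basis : Fin 3 → Matrix (Fin 3) (Fin 3) ℝ :=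
  ![!![0, 1, 0; 0, 0, 0; 0, 0, 0], !![0, 0, 0; 0, 0, 1; 0, 0, 0], !![0, 0, 1; 0, 0, 0; 0, 0, 0]]

/-- The coordinates, in the basis `e₁, e₂, e₃`, of a matrix in the Lie algebra of `Nil`. The inner
product on the Lie algebra that makes the basis orthonormal is the dot product of coordinates. -/
def coords (A : Matrix (Fin 3) (Fin 3) ℝ) : Fin 3 → ℝ :=
  fun k => Matrix.trace ((basis k)ᵀ * A)

/-- The coordinates of the left translate `g⁻¹ X` to the unit of a tangent vector `X` at `g`. -/
def leftCoords (g : Nil) (X : Matrix (Fin 3) (Fin 3) ℝ) : Fin 3 → ℝ :=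
  coords (((g⁻¹ : Nil) : Matrix.SpecialLinearGroup (Fin 3) ℝ) * X)

/-- The left-invariant metric on `Nil` for which `e₁, e₂, e₃` are orthonormal at the unit. -/
def metric (g : Nil) (X Y : Matrix (Fin 3) (Fin 3) ℝ) : ℝ :=
  leftCoords g X ⬝ᵥ leftCoords g Y

theorem coords_apply (A : Matrix (Fin 3) (Fin 3) ℝ) (k : Fin 3) :
    coords A k = ![A 0 1, A 1 2, A 0 2] k := by
  fin_cases k <;>
    simp [coords, basis, Matrix.trace, Fin.sum_univ_three,
      Matrix.mul_apply]

/-- The metric is `dx² + dy² + (dz - x dy)²`. -/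
theorem metric_self (g : Nil) {x y z : ℝ}
    (hg : ((g : Matrix.SpecialLinearGroup (Fin 3) ℝ) : Matrix (Fin 3) (Fin 3) ℝ) =
      !![1, x, z; 0, 1, y; 0, 0, 1]) (dx dy dz : ℝ) :
    metric g !![0, dx, dz; 0, 0, dy; 0, 0, 0] !![0, dx, dz; 0, 0, dy; 0, 0, 0] =
      dx ^ 2 + dy ^ 2 + (dz - x * dy) ^ 2 := by
  simp only [metric, leftCoords, dotProduct, coords_apply, Subgroup.coe_inv,
    Matrix.SpecialLinearGroup.coe_inv, hg, Matrix.adjugate_fin_three]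
  simp [Fin.sum_univ_three]
  ring

/-- The structure constants `α i j k = ⟨[e i, e j], e k⟩`. -/
def structureConst (i j k : Fin 3) : ℝ :=
  coords (basis i * basis j - basis j * basis i) k

/-- The bracket of left-invariant vector fields, in coordinates. -/
def bracket (X Y : Fin 3 → ℝ) : Fin 3 → ℝ :=
  fun k => ∑ i, ∑ j, X i * Y j * structureConst i j k

/-- The coefficient `⟨∇_{e k} (e j), e i⟩` of the Levi-Civita connection of the left-invariant
metric (Koszul formula in the orthonormal left-invariant frame). -/
def connCoeff (k j i : Fin 3) : ℝ :=
  (structureConst k j i + structureConst i k j + structureConst i j k) / 2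

/-- The Levi-Civita connection on left-invariant vector fields, in coordinates. -/
def nabla (X Y : Fin 3 → ℝ) : Fin 3 → ℝ :=
  fun i => ∑ k, ∑ j, X k * Y j * connCoeff k j i

theorem structureConst_swap (i j k : Fin 3) :
    structureConst j i k = -structureConst i j k := by
  simp only [structureConst, coords, ← Matrix.trace_neg, ← Matrix.mul_neg, neg_sub]

/-- The connection is torsion-free: `∇_X Y - ∇_Y X = [X, Y]`. -/
theorem connCoeff_torsionFree (k j i : Fin 3) :
    connCoeff k j i - connCoeff j k i = structureConst k j i := by
  simp only [connCoeff]
  linarith [structureConst_swap k j i]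

/-- The connection is metric: `⟨∇_X Y, W⟩ + ⟨Y, ∇_X W⟩ = 0` for left-invariant fields. -/
theorem connCoeff_metric (k j i : Fin 3) : connCoeff k j i + connCoeff k i j = 0 := by
  simp only [connCoeff]
  linarith [structureConst_swap k j i, structureConst_swap i k j, structureConst_swap i j k]

/-- The curvature tensor `R(X,Y)W = ∇_Y ∇_X W - ∇_X ∇_Y W + ∇_{[X,Y]} W`. -/
def curvature (X Y W : Fin 3 → ℝ) : Fin 3 → ℝ :=
  nabla Y (nabla X W) - nabla X (nabla Y W) + nabla (bracket X Y) W

/-- The sectional curvature of the plane spanned by two linearly independent vectors. -/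
def sectionalCurvature (X Y : Fin 3 → ℝ) : ℝ :=
  (curvature X Y X ⬝ᵥ Y) / ((X ⬝ᵥ X) * (Y ⬝ᵥ Y) - (X ⬝ᵥ Y) ^ 2)

/-! ## Surfaces in Nil -/

section Surface

variable {M : Type*} [TopologicalSpace M]

/-- The derivative `∂_v f` in direction `v`, a matrix tangent to `Nil`, at the point `z` of the
domain of the parameter `c`. -/
def dirDeriv (f : M → Nil) (c : OpenPartialHomeomorph M ℂ) (v z : ℂ) :
    Matrix (Fin 3) (Fin 3) ℝ :=
  Matrix.of fun i j => fderiv ℝ (fun w => ((f (c.symm w) : Matrix.SpecialLinearGroup (Fin 3) ℝ) :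
    Matrix (Fin 3) (Fin 3) ℝ) i j) z v

/-- The left translate `f⁻¹ ∂_v f`, in coordinates. -/
def leftDeriv (f : M → Nil) (c : OpenPartialHomeomorph M ℂ) (v z : ℂ) : Fin 3 → ℝ :=
  leftCoords (f (c.symm z)) (dirDeriv f c v z)

/-- The coefficients of the first fundamental form in the parameter `c`:
`firstForm f c v w z = ⟨∂_v f, ∂_w f⟩`. -/
def firstForm (f : M → Nil) (c : OpenPartialHomeomorph M ℂ) (v w z : ℂ) : ℝ :=
  metric (f (c.symm z)) (dirDeriv f c v z) (dirDeriv f c w z)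

/-- `E G - F²` for the first fundamental form `E dx² + 2 F dx dy + G dy²`. -/
def firstFormDet (f : M → Nil) (c : OpenPartialHomeomorph M ℂ) (z : ℂ) : ℝ :=
  firstForm f c 1 1 z * firstForm f c Complex.I Complex.I z - firstForm f c 1 Complex.I z ^ 2

/-- The left translate `f⁻¹(N)` of the unit normal, with `(∂_x f, ∂_y f, N)` positively oriented
(the basis `e₁, e₂, e₃` being positively oriented). -/
def unitNormal (f : M → Nil) (c : OpenPartialHomeomorph M ℂ) (z : ℂ) : Fin 3 → ℝ :=
  let n := leftDeriv f c 1 z ⨯₃ leftDeriv f c Complex.I z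
  (Real.sqrt (n ⬝ᵥ n))⁻¹ • n

/-- The left translate of the covariant derivative `∇_{∂_v f} (∂_w f)` along `f`. -/
def covDeriv (f : M → Nil) (c : OpenPartialHomeomorph M ℂ) (v w z : ℂ) : Fin 3 → ℝ :=
  fun k => fderiv ℝ (fun ζ => leftDeriv f c w ζ k) z v +
    nabla (leftDeriv f c v z) (leftDeriv f c w z) k

/-- The second fundamental form `⟨∇_{∂_v f} (∂_w f), N⟩`. -/
def secondForm (f : M → Nil) (c : OpenPartialHomeomorph M ℂ) (v w z : ℂ) : ℝ :=
  covDeriv f c v w z ⬝ᵥ unitNormal f c z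

/-- The mean curvature, half the trace of the second fundamental form with respect to the first,
computed in the parameter `c`. -/
def meanCurvatureIn (f : M → Nil) (c : OpenPartialHomeomorph M ℂ) (z : ℂ) : ℝ :=
  (firstForm f c Complex.I Complex.I z * secondForm f c 1 1 z
    - 2 * firstForm f c 1 Complex.I z * secondForm f c 1 Complex.I z
    + firstForm f c 1 1 z * secondForm f c Complex.I Complex.I z) / (2 * firstFormDet f c z)

/-- The mean curvature `H` of the surface at a point. -/
def meanCurvature [ChartedSpace ℂ M] (f : M → Nil) (p : M) : ℝ :=
  meanCurvatureIn f (chartAt ℂ p) (chartAt ℂ p p)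

/-- The sectional curvature in `Nil` of the tangent plane of the surface at a point. -/
def tangentCurvature [ChartedSpace ℂ M] (f : M → Nil) (p : M) : ℝ :=
  sectionalCurvature (leftDeriv f (chartAt ℂ p) 1 (chartAt ℂ p p))
    (leftDeriv f (chartAt ℂ p) Complex.I (chartAt ℂ p p))

/-- The area measure of the induced metric, in the domain of one parameter:
`√(E G - F²) dx dy`. -/
def localArea [MeasurableSpace M] (f : M → Nil) (c : OpenPartialHomeomorph M ℂ) : Measure M :=
  (((volume : Measure ℂ).restrict c.target).withDensity
    fun z => ENNReal.ofReal (Real.sqrt (firstFormDet f c z))).map c.symm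

/-- The induced area measure `dμ` on the surface. The local area measures agree on overlaps, and
their supremum is the measure that restricts to each of them. -/
def areaMeasure [ChartedSpace ℂ M] [MeasurableSpace M] (f : M → Nil) : Measure M :=
  ⨆ c ∈ atlas ℂ M, localArea f c

/-- A smooth immersion of a Riemann surface in `Nil` for which the local complex coordinates are
conformal parameters of the induced metric. -/
structure IsConformalImmersion [ChartedSpace ℂ M] (f : M → Nil) : Prop where
  smooth : ∀ i j, ContMDiff 𝓘(ℝ, ℂ) 𝓘(ℝ, ℝ) ∞ fun p =>
    ((f p : Matrix.SpecialLinearGroup (Fin 3) ℝ) : Matrix (Fin 3) (Fin 3) ℝ) i j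
  immersion : ∀ c ∈ atlas ℂ M, ∀ z ∈ c.target,
    LinearIndependent ℝ ![leftDeriv f c 1 z, leftDeriv f c Complex.I z]
  conformal : ∀ c ∈ atlas ℂ M, ∀ z ∈ c.target,
    firstForm f c 1 1 z = firstForm f c Complex.I Complex.I z ∧ firstForm f c 1 Complex.I z = 0

/-! ## Generating spinors, Dirac potentials and the energy -/

/-- The Wirtinger derivative `∂ = (∂_x - i ∂_y) / 2`. -/
def dz (g : ℂ → ℂ) (z : ℂ) : ℂ :=
  (fderiv ℝ g z 1 - Complex.I * fderiv ℝ g z Complex.I) / 2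

/-- The Wirtinger derivative `∂̄ = (∂_x + i ∂_y) / 2`. -/
def dzbar (g : ℂ → ℂ) (z : ℂ) : ℂ :=
  (fderiv ℝ g z 1 + Complex.I * fderiv ℝ g z Complex.I) / 2

/-- The components `Z₁, Z₂, Z₃` of `Ψ = f⁻¹ ∂f`. -/
def Zcomp (f : M → Nil) (c : OpenPartialHomeomorph M ℂ) (k : Fin 3) (z : ℂ) : ℂ :=
  ((leftDeriv f c 1 z k : ℂ) - Complex.I * (leftDeriv f c Complex.I z k : ℂ)) / 2

/-- `ψ = (ψ₁, ψ₂)` is a generating spinor of the surface on the set `D` of values of the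
parameter `c`. -/
structure IsGeneratingSpinor (f : M → Nil) (c : OpenPartialHomeomorph M ℂ) (D : Set ℂ)
    (ψ₁ ψ₂ : ℂ → ℂ) : Prop where
  smooth₁ : ContDiffOn ℝ ∞ ψ₁ D
  smooth₂ : ContDiffOn ℝ ∞ ψ₂ D
  eq₁ : ∀ z ∈ D, Zcomp f c 0 z = Complex.I / 2 * ((star (ψ₂ z)) ^ 2 + ψ₁ z ^ 2)
  eq₂ : ∀ z ∈ D, Zcomp f c 1 z = 1 / 2 * ((star (ψ₂ z)) ^ 2 - ψ₁ z ^ 2)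
  eq₃ : ∀ z ∈ D, Zcomp f c 2 z = ψ₁ z * star (ψ₂ z)

/-- `U`, `V` are continuous potentials on `D` of a Dirac operator annihilating `ψ`:
`∂ψ₂ + U ψ₁ = 0` and `-∂̄ψ₁ + V ψ₂ = 0`. -/
structure IsDiracPotential (D : Set ℂ) (ψ₁ ψ₂ U V : ℂ → ℂ) : Prop where
  continuous₁ : ContinuousOn U D
  continuous₂ : ContinuousOn V D
  eq₁ : ∀ z ∈ D, dz ψ₂ z + U z * ψ₁ z = 0
  eq₂ : ∀ z ∈ D, -dzbar ψ₁ z + V z * ψ₂ z = 0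

/-- A representation of the surface by generating spinors: a cutting of the surface into finitely
many disjoint Borel pieces, and around each piece a conformal parameter, a generating spinor and
the potentials of its Dirac operator. -/
structure SpinorRepresentation [ChartedSpace ℂ M] [MeasurableSpace M] (f : M → Nil) where
  n : ℕ
  piece : Fin n → Set M
  measurable_piece : ∀ i, MeasurableSet (piece i)
  disjoint_piece : Pairwise fun i j => Disjoint (piece i) (piece j)
  cover : ⋃ i, piece i = Set.univ
  param : Fin n → OpenPartialHomeomorph M ℂ
  param_mem : ∀ i, param i ∈ IsManifold.maximalAtlas 𝓘(ℂ, ℂ) ω M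
  piece_subset : ∀ i, piece i ⊆ (param i).source
  dom : Fin n → Set ℂ
  isOpen_dom : ∀ i, IsOpen (dom i)
  dom_subset : ∀ i, dom i ⊆ (param i).target
  image_subset : ∀ i, param i '' piece i ⊆ dom i
  ψ₁ : Fin n → ℂ → ℂ
  ψ₂ : Fin n → ℂ → ℂ
  U : Fin n → ℂ → ℂ
  V : Fin n → ℂ → ℂ
  spinor : ∀ i, IsGeneratingSpinor f (param i) (dom i) (ψ₁ i) (ψ₂ i)
  dirac : ∀ i, IsDiracPotential (dom i) (ψ₁ i) (ψ₂ i) (U i) (V i)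

/-- Integrability on the surface of the 2-form `U V dx ∧ dy`. -/
def SpinorRepresentation.IsIntegrable [ChartedSpace ℂ M] [MeasurableSpace M] {f : M → Nil}
    (S : SpinorRepresentation f) : Prop :=
  ∀ i, IntegrableOn (fun z => S.U i z * S.V i z) (S.param i '' S.piece i)

/-- The energy `E(M) = ∫_M U V dx ∧ dy`. -/
def SpinorRepresentation.energy [ChartedSpace ℂ M] [MeasurableSpace M] {f : M → Nil}
    (S : SpinorRepresentation f) : ℂ :=
  ∑ i, ∫ z in S.param i '' S.piece i, S.U i z * S.V i z

end Surface

end Nil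

end

/-!
In the left-invariant frame, the tension of a conformal immersion is normal to the surface, with
length given by `H`, while the Maurer–Cartan equation expresses the skew part of the second
derivatives through `f⁻¹ df`. Together they determine `∂̄Z`, and inserting the formulas for `Z` in
terms of `ψ` turns this into the Dirac equation with `e^α = |ψ₁|² + |ψ₂|²` and
`U = V = (H/2) e^α + (i/4) (|ψ₂|² - |ψ₁|²)`. By that equation neither component of `ψ` vanishes on
a nonempty open set, so these are the only continuous potentials.

If `N₃` is the third component of the unit normal, then `N₃ e^α = |ψ₂|² - |ψ₁|²` and
`K̂ = 1/4 - N₃²`, whence `U V = e^{2α} (H²/4 - N₃²/16 + (i/4) H N₃)` has the required real part.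
Its imaginary part integrates to zero because `e₃` is a Killing field: the tangential part of `e₃`
has divergence `2 H N₃`.
-/

noncomputable section

open Filter
open scoped Topology
open Complex (I)

/-! ### Cross products and plane rotations of frames -/

theorem crossProduct_dotProduct_self {R : Type*} [CommRing R] (a b : Fin 3 → R) :
    a ⨯₃ b ⬝ᵥ a ⨯₃ b = (a ⬝ᵥ a) * (b ⬝ᵥ b) - (a ⬝ᵥ b) ^ 2 := by
  rw [cross_dot_cross, dotProduct_comm b a, sq]

theorem dotProduct_self_smul_eq_smul_crossProduct {R : Type*} [CommRing R] {a b v : Fin 3 → R}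
    (ha : v ⬝ᵥ a = 0) (hb : v ⬝ᵥ b = 0) :
    (a ⨯₃ b ⬝ᵥ a ⨯₃ b) • v = (v ⬝ᵥ a ⨯₃ b) • (a ⨯₃ b) := by
  have parallel : v ⨯₃ (a ⨯₃ b) = 0 := by
    rw [cross_cross_eq_smul_sub_smul', dotProduct_comm a v, ha, hb, zero_smul, zero_smul, sub_zero]
  have expansion := cross_cross_eq_smul_sub_smul' (a ⨯₃ b) v (a ⨯₃ b)
  rwa [parallel, map_zero, eq_comm, sub_eq_zero] at expansion

theorem crossProduct_rotation {R : Type*} [CommRing R] (u v : R) (a b : Fin 3 → R) :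
    (u • a + v • b) ⨯₃ (-v • a + u • b) = (u ^ 2 + v ^ 2) • (a ⨯₃ b) := by
  simp only [map_add, map_smul, LinearMap.add_apply, LinearMap.smul_apply, cross_self,
    ← cross_anticomm a b]
  module

/-! ### Calculus with complex parameters -/

theorem map_eq_re_smul_add_im_smul {E F : Type*} [AddCommMonoid E] [Module ℝ E] [FunLike F ℂ E]
    [LinearMapClass F ℝ ℂ E] (L : F) (v : ℂ) : L v = v.re • L 1 + v.im • L I := by
  rw [← map_smul, ← map_smul, ← map_add]
  simp [Complex.re_add_im]

section NormedSpace

variable {𝕜 E F : Type*} [NontriviallyNormedField 𝕜] [NormedAddCommGroup E] [NormedSpace 𝕜 E]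
  [NormedAddCommGroup F] [NormedSpace 𝕜 F]

theorem contDiffOn_fderiv_apply {g : E → F} {s : Set E} {m n : WithTop ℕ∞} (hs : IsOpen s)
    (hg : ContDiffOn 𝕜 n g s) (hmn : m + 1 ≤ n) (v : E) :
    ContDiffOn 𝕜 m (fun x => fderiv 𝕜 g x v) s :=
  (hg.fderiv_of_isOpen hs hmn).clm_apply contDiffOn_const

theorem fderiv_fderiv_apply_comm {g : E → F} {x : E} {n : WithTop ℕ∞} (hg : ContDiffAt 𝕜 n g x)
    (hn : minSmoothness 𝕜 2 ≤ n) (v w : E) :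
    fderiv 𝕜 (fun y => fderiv 𝕜 g y v) x w = fderiv 𝕜 (fun y => fderiv 𝕜 g y w) x v := by
  have hd : DifferentiableAt 𝕜 (fderiv 𝕜 g) x :=
    (hg.fderiv_right (m := 1) (le_minSmoothness.trans hn)).differentiableAt one_ne_zero
  rw [fderiv_clm_apply hd (differentiableAt_const v),
    fderiv_clm_apply hd (differentiableAt_const w)]
  simpa using (hg.isSymmSndFDerivAt hn).eq w v

theorem fderiv_comp_restrictScalars {𝕜' : Type*} [NontriviallyNormedField 𝕜'] [NormedAlgebra 𝕜 𝕜']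
    {g : 𝕜' → F} {φ : 𝕜' → 𝕜'} {z : 𝕜'} (hg : DifferentiableAt 𝕜 g (φ z))
    (hφ : DifferentiableAt 𝕜' φ z) (v : 𝕜') :
    fderiv 𝕜 (g ∘ φ) z v = fderiv 𝕜 g (φ z) (deriv φ z * v) := by
  have h := hφ.hasFDerivAt.restrictScalars 𝕜
  rw [(hg.hasFDerivAt.comp z h).fderiv]
  simp [mul_comm]

end NormedSpace

/-! ### Charts -/

section Charts

theorem contDiffGroupoid_le_restrictScalars {𝕜 𝕜' E : Type*} [NontriviallyNormedField 𝕜]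
    [NontriviallyNormedField 𝕜'] [NormedAlgebra 𝕜 𝕜'] [NormedAddCommGroup E] [NormedSpace 𝕜 E]
    [NormedSpace 𝕜' E] [IsScalarTower 𝕜 𝕜' E] {m n : WithTop ℕ∞} (hmn : m ≤ n) :
    contDiffGroupoid n 𝓘(𝕜', E) ≤ contDiffGroupoid m 𝓘(𝕜, E) := by
  intro e he
  have restrict {e : OpenPartialHomeomorph E E} (he : e ∈ contDiffGroupoid n 𝓘(𝕜', E)) :
      ContDiffOn 𝕜 m e e.source :=
    ((contMDiffOn_iff_contDiffOn.1 (contMDiffOn_of_mem_contDiffGroupoid he)).restrict_scalars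
      𝕜).of_le hmn
  change e ∈ contDiffGroupoid m 𝓘(𝕜, E)
  rw [contDiffGroupoid, mem_groupoid_of_pregroupoid, contDiffPregroupoid]
  exact ⟨by simpa using restrict he, by simpa using restrict (StructureGroupoid.symm _ he)⟩

theorem continuous_of_forall_chartAt {H M X : Type*} [TopologicalSpace H] [TopologicalSpace M]
    [ChartedSpace H M] [TopologicalSpace X] {g : M → X} {G : M → H → X}
    (hG : ∀ p, ContinuousOn (G p) (chartAt H p).target)
    (h : ∀ p, ∀ q ∈ (chartAt H p).source, g q = G p (chartAt H p q)) : Continuous g := by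
  refine continuous_iff_continuousAt.2 fun p => ?_
  have composite : ContinuousOn (fun q => G p (chartAt H p q)) (chartAt H p).source :=
    (hG p).comp (chartAt H p).continuousOn (chartAt H p).mapsTo
  exact (composite.congr (h p)).continuousAt
    ((chartAt H p).open_source.mem_nhds (mem_chart_source H p))

end Charts

/-! ### Measures -/

section Measures

theorem exists_fin_measurable_partition {X : Type*} [TopologicalSpace X] [CompactSpace X]
    [MeasurableSpace X] [OpensMeasurableSpace X] (U : X → Set X) (hU : ∀ x, U x ∈ 𝓝 x)
    (hUo : ∀ x, IsOpen (U x)) :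
    ∃ (n : ℕ) (x : Fin n → X) (P : Fin n → Set X), (∀ i, MeasurableSet (P i)) ∧
      (Pairwise fun i j => Disjoint (P i) (P j)) ∧ (⋃ i, P i = Set.univ) ∧
      ∀ i, P i ⊆ U (x i) := by
  obtain ⟨t, -, ht⟩ := isCompact_univ.elim_nhds_subcover U fun x _ => hU x
  let x : Fin t.card → X := fun i => t.equivFin.symm i
  refine ⟨t.card, x, disjointed (U ∘ x), fun i => ?_, disjoint_disjointed _, ?_,
    disjointed_subset _⟩
  · exact disjointedRec (fun _ _ h => h.diff (hUo _).measurableSet) (hUo _).measurableSet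
  · rw [iUnion_disjointed, Set.eq_univ_iff_forall]
    intro p
    obtain ⟨y, hy, hpy⟩ := Set.mem_iUnion₂.1 (ht (Set.mem_univ p))
    exact Set.mem_iUnion.2 ⟨t.equivFin ⟨y, hy⟩, by simpa [x] using hpy⟩

theorem restrict_iSup_eq_of_restrict_le {ι X : Type*} [MeasurableSpace X] {ν : ι → Measure X}
    {s : Set X} (hs : MeasurableSet s) {i : ι} (self : (ν i).restrict s = ν i)
    (restrict_le : ∀ j, (ν j).restrict s ≤ ν i) : (⨆ j, ν j).restrict s = ν i := by
  have iSup_le_add : ⨆ j, ν j ≤ ν i + (⨆ j, ν j).restrict sᶜ := iSup_le fun j =>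
    calc ν j = (ν j).restrict s + (ν j).restrict sᶜ := (Measure.restrict_add_restrict_compl hs).symm
      _ ≤ ν i + (⨆ j, ν j).restrict sᶜ :=
        add_le_add (restrict_le j) (Measure.restrict_mono_measure (le_iSup ν j) _)
  refine le_antisymm ?_ ?_
  · simpa [Measure.restrict_restrict hs, self] using Measure.restrict_mono_measure iSup_le_add s
  · exact self.ge.trans (Measure.restrict_mono_measure (le_iSup ν i) s)

theorem det_restrictScalars_toSpanSingleton (w : ℂ) :
    ((ContinuousLinearMap.toSpanSingleton ℂ w).restrictScalars ℝ).det = Complex.normSq w := by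
  rw [← Algebra.norm_complex_apply, ContinuousLinearMap.det, Algebra.norm_apply]
  congr 1
  ext
  simp [mul_comm]

variable {X Y : Type*} [TopologicalSpace X] [TopologicalSpace Y] [MeasurableSpace X]
  [BorelSpace X] [MeasurableSpace Y] [OpensMeasurableSpace Y]
  {e : OpenPartialHomeomorph X Y} {s : Set X}

theorem measurableSet_target_inter_preimage_symm (hs : MeasurableSet s) :
    MeasurableSet (e.target ∩ e.symm ⁻¹' s) := by
  have h : Measurable (e.target.domRestrict e.symm) :=
    (continuousOn_iff_continuous_domRestrict.1 e.continuousOn_symm).measurable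
  have image_eq : Subtype.val '' (e.target.domRestrict e.symm ⁻¹' s) =
      e.target ∩ e.symm ⁻¹' s := by
    rw [Set.domRestrict_eq, Set.preimage_comp, Subtype.image_preimage_coe]
  exact image_eq ▸ e.open_target.measurableSet.subtype_image (h hs)

theorem measurableSet_image_of_subset_source (hs : MeasurableSet s) (hse : s ⊆ e.source) :
    MeasurableSet (e '' s) := by
  rw [e.image_eq_target_inter_inv_preimage hse]
  exact measurableSet_target_inter_preimage_symm hs

theorem restrict_map_symm (μ : Measure Y) (hs : MeasurableSet s) (hse : s ⊆ e.source) :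
    ((μ.restrict e.target).map e.symm).restrict s = (μ.restrict (e '' s)).map e.symm := by
  have aemeasurable_symm : AEMeasurable e.symm (μ.restrict e.target) :=
    e.continuousOn_symm.aemeasurable e.open_target.measurableSet
  have image_eq := e.image_eq_target_inter_inv_preimage hse
  rw [Measure.restrict_map_of_aemeasurable aemeasurable_symm hs,
    Measure.restrict_restrict' e.open_target.measurableSet, Set.inter_comm, image_eq]

end Measures

/-! ### Integrals of derivatives -/

theorem indicator_eventuallyEq_zero {X Y : Type*} [TopologicalSpace X] [Zero Y] {s K : Set X}
    {h : X → Y} (hK : IsClosed K) (hKs : K ⊆ s)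
    (h_zero : ∀ z ∈ s, z ∉ K → h z = 0) {z : X} (hz : z ∉ s) :
    s.indicator h =ᶠ[𝓝 z] 0 := by
  filter_upwards [hK.isOpen_compl.mem_nhds fun hzK => hz (hKs hzK)] with w hw
  exact Set.indicator_apply_eq_zero.2 fun hws => h_zero w hws hw

theorem indicator_eventuallyEq_self {X Y : Type*} [TopologicalSpace X] [Zero Y] {s : Set X}
    (hs : IsOpen s) (h : X → Y) {z : X} (hz : z ∈ s) :
    s.indicator h =ᶠ[𝓝 z] h :=
  (Set.eqOn_indicator (f := h)).eventuallyEq_of_mem (hs.mem_nhds hz)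

theorem hasCompactSupport_indicator {X Y : Type*} [TopologicalSpace X] [R1Space X] [Zero Y]
    {s K : Set X} {h : X → Y} (hK : IsCompact K) (h_zero : ∀ z ∈ s, z ∉ K → h z = 0) :
    HasCompactSupport (s.indicator h) :=
  .intro hK fun z hz => Set.indicator_apply_eq_zero.2 fun hzs => h_zero z hzs hz

section IntegralFderiv

variable {E F : Type*} [NormedAddCommGroup E] [NormedSpace ℝ E] [NormedAddCommGroup F]
  [NormedSpace ℝ F] {s K : Set E} {h : E → F}

theorem contDiff_indicator (hs : IsOpen s) (hK : IsClosed K) (hKs : K ⊆ s) {n : ℕ∞ω}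
    (hh : ContDiffOn ℝ n h s) (h_zero : ∀ z ∈ s, z ∉ K → h z = 0) :
    ContDiff ℝ n (s.indicator h) := by
  refine contDiff_iff_contDiffAt.2 fun z => ?_
  by_cases hz : z ∈ s
  · exact (hh.contDiffAt (hs.mem_nhds hz)).congr_of_eventuallyEq
      (indicator_eventuallyEq_self hs h hz)
  · exact contDiffAt_const.congr_of_eventuallyEq (indicator_eventuallyEq_zero hK hKs h_zero hz)

theorem fderiv_indicator_apply (hs : IsOpen s) (hK : IsClosed K) (hKs : K ⊆ s)
    (h_zero : ∀ z ∈ s, z ∉ K → h z = 0) (v : E) :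
    (fun z => fderiv ℝ (s.indicator h) z v) = s.indicator fun z => fderiv ℝ h z v := by
  ext1 z
  by_cases hz : z ∈ s
  · rw [(indicator_eventuallyEq_self hs h hz).fderiv_eq, Set.indicator_of_mem hz]
  · rw [(indicator_eventuallyEq_zero hK hKs h_zero hz).fderiv_eq, Set.indicator_of_notMem hz,
      fderiv_zero, Pi.zero_apply, zero_apply]

variable [MeasurableSpace E] [BorelSpace E] {μ : Measure E}

theorem integrable_fderiv_apply [IsFiniteMeasureOnCompacts μ] (hh : ContDiff ℝ 1 h)
    (hsupp : HasCompactSupport h) (v : E) : Integrable (fun z => fderiv ℝ h z v) μ :=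
  ((hh.continuous_fderiv (by simp)).clm_apply continuous_const).integrable_of_hasCompactSupport
    (hsupp.fderiv_apply ℝ v)

theorem integrableOn_fderiv_apply [IsFiniteMeasureOnCompacts μ] (hs : IsOpen s)
    (hK : IsCompact K) (hKs : K ⊆ s) (hh : ContDiffOn ℝ 1 h s)
    (h_zero : ∀ z ∈ s, z ∉ K → h z = 0) (v : E) :
    IntegrableOn (fun z => fderiv ℝ h z v) s μ := by
  rw [← integrable_indicator_iff hs.measurableSet,
    ← fderiv_indicator_apply hs hK.isClosed hKs h_zero]
  exact integrable_fderiv_apply (contDiff_indicator hs hK.isClosed hKs hh h_zero)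
    (hasCompactSupport_indicator hK h_zero) v

variable [FiniteDimensional ℝ E] [μ.IsAddHaarMeasure]

theorem integral_fderiv_apply_eq_zero (hh : ContDiff ℝ 1 h) (hsupp : HasCompactSupport h)
    (v : E) : ∫ z, fderiv ℝ h z v ∂μ = 0 := by
  have integral_by_parts := integral_smul_fderiv_eq_neg_fderiv_smul_of_integrable (μ := μ) (𝕜 := ℝ)
    (f := fun _ : E => (1 : ℝ)) (g := h) (v := v) (by simp)
    (by simpa using integrable_fderiv_apply hh hsupp v)
    (by simpa using hh.continuous.integrable_of_hasCompactSupport hsupp)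
    (fun _ _ => differentiableAt_const _) (fun z _ => hh.differentiable (by simp) z)
  simpa using integral_by_parts

theorem setIntegral_fderiv_apply_eq_zero (hs : IsOpen s) (hK : IsCompact K) (hKs : K ⊆ s)
    (hh : ContDiffOn ℝ 1 h s) (h_zero : ∀ z ∈ s, z ∉ K → h z = 0) (v : E) :
    ∫ z in s, fderiv ℝ h z v ∂μ = 0 := by
  rw [← integral_indicator hs.measurableSet,
    ← fderiv_indicator_apply hs hK.isClosed hKs h_zero]
  exact integral_fderiv_apply_eq_zero (contDiff_indicator hs hK.isClosed hKs hh h_zero)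
    (hasCompactSupport_indicator hK h_zero) v

end IntegralFderiv

/-! ### Local square roots and factorizations -/

section Factorization

theorem eq_and_eq_of_mul_eq_mul {R : Type*} [CommRing R] [IsDomain R] {a b x y x' y' : R}
    (h : a ≠ 0 ∨ b ≠ 0) (ha : a * x = a * x') (hb : b * y = b * y')
    (hab : a * y + b * x = a * y' + b * x') : x = x' ∧ y = y' := by
  rcases h with h | h
  · obtain rfl := mul_left_cancel₀ h ha
    exact ⟨rfl, mul_left_cancel₀ h (add_right_cancel hab)⟩
  · obtain rfl := mul_left_cancel₀ h hb
    exact ⟨mul_left_cancel₀ h (add_left_cancel hab), rfl⟩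

variable {E : Type*} [NormedAddCommGroup E] [NormedSpace ℝ E] {n : WithTop ℕ∞} {s : Set E} {z : E}

theorem exists_contDiffOn_sq_eq {g : E → ℂ} (hs : IsOpen s) (hg : ContDiffOn ℝ n g s)
    (hz : z ∈ s) (hgz : g z ≠ 0) :
    ∃ D ⊆ s, IsOpen D ∧ z ∈ D ∧ ∃ r : E → ℂ, ContDiffOn ℝ n r D ∧
      ∀ ζ ∈ D, r ζ ^ 2 = g ζ ∧ r ζ ≠ 0 := by
  obtain ⟨w, hw⟩ := IsAlgClosed.exists_pow_nat_eq (g z) two_pos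
  have hw0 : w ≠ 0 := by
    rintro rfl
    exact hgz (by simpa using hw.symm)
  refine ⟨s ∩ (fun ζ => g ζ / g z) ⁻¹' Complex.slitPlane, Set.inter_subset_left,
    (hg.continuousOn.div_const _).isOpen_inter_preimage hs Complex.isOpen_slitPlane,
    ⟨hz, by simp [div_self hgz]⟩, fun ζ => w * Complex.exp (Complex.log (g ζ / g z) / 2), ?_, ?_⟩
  · intro ζ hζ
    have quotient : ContDiffWithinAt ℝ n (fun ζ => g ζ / g z)
        (s ∩ (fun ζ => g ζ / g z) ⁻¹' Complex.slitPlane) ζ :=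
      ((hg ζ hζ.1).mono Set.inter_subset_left).div_const _
    have sqrt : ContDiffAt ℝ n (fun u : ℂ => w * Complex.exp (Complex.log u / 2)) (g ζ / g z) :=
      (contDiffAt_const.mul ((Complex.contDiffAt_log hζ.2).div_const 2).cexp).restrict_scalars ℝ
    exact ContDiffAt.comp_contDiffWithinAt (f := fun ζ => g ζ / g z) ζ sqrt quotient
  · intro ζ hζ
    refine ⟨?_, mul_ne_zero hw0 (Complex.exp_ne_zero _)⟩
    rw [mul_pow, hw, ← Complex.exp_nat_mul, Nat.cast_two, mul_div_cancel₀ _ two_ne_zero,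
      Complex.exp_log (Complex.slitPlane_ne_zero hζ.2), mul_div_cancel₀ _ hgz]

theorem exists_contDiffOn_sq_sq_mul {A B C : E → ℂ} (hs : IsOpen s) (hA : ContDiffOn ℝ n A s)
    (hB : ContDiffOn ℝ n B s) (hC : ContDiffOn ℝ n C s) (hABC : ∀ ζ ∈ s, A ζ * B ζ = C ζ ^ 2)
    (hz : z ∈ s) (hne : A z ≠ 0 ∨ B z ≠ 0) :
    ∃ D ⊆ s, IsOpen D ∧ z ∈ D ∧ ∃ a b : E → ℂ, ContDiffOn ℝ n a D ∧ ContDiffOn ℝ n b D ∧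
      ∀ ζ ∈ D, a ζ ^ 2 = A ζ ∧ b ζ ^ 2 = B ζ ∧ a ζ * b ζ = C ζ := by
  wlog hAz : A z ≠ 0 generalizing A B
  · obtain ⟨D, hDs, hDo, hzD, b, a, hb, ha, h⟩ := this hB hA
      (fun ζ hζ => (mul_comm _ _).trans (hABC ζ hζ)) hne.symm (hne.resolve_left hAz)
    exact ⟨D, hDs, hDo, hzD, a, b, ha, hb, fun ζ hζ =>
      ⟨(h ζ hζ).2.1, (h ζ hζ).1, (mul_comm _ _).trans (h ζ hζ).2.2⟩⟩
  obtain ⟨D, hDs, hDo, hzD, a, ha, h⟩ := exists_contDiffOn_sq_eq hs hA hz hAz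
  refine ⟨D, hDs, hDo, hzD, a, fun ζ => C ζ * (a ζ)⁻¹, ha,
    (hC.mono hDs).mul (ha.inv fun ζ hζ => (h ζ hζ).2), fun ζ hζ => ?_⟩
  obtain ⟨ha2, ha0⟩ := h ζ hζ
  refine ⟨ha2, ?_, by rw [mul_comm, inv_mul_cancel_right₀ ha0]⟩
  rw [mul_pow, ← hABC ζ (hDs hζ), ← ha2, mul_right_comm, ← mul_pow, mul_inv_cancel₀ ha0, one_pow,
    one_mul]

end Factorization

namespace Nil

/-! ### The left-invariant frame -/

theorem nabla_apply (X Y : Fin 3 → ℝ) :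
    nabla X Y = ![(X 1 * Y 2 + X 2 * Y 1) / 2, -(X 0 * Y 2 + X 2 * Y 0) / 2,
      (X 0 * Y 1 - X 1 * Y 0) / 2] := by
  ext i
  fin_cases i <;>
    simp [nabla, connCoeff, structureConst, coords_apply, basis, Fin.sum_univ_three,
      Matrix.mul_apply] <;>
    ring

theorem bracket_apply (X Y : Fin 3 → ℝ) :
    bracket X Y = ![0, 0, X 0 * Y 1 - X 1 * Y 0] := by
  ext i
  fin_cases i <;>
    simp [bracket, structureConst, coords_apply, basis, Fin.sum_univ_three, Matrix.mul_apply]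
  ring

theorem nabla_sub_nabla (X Y : Fin 3 → ℝ) : nabla X Y - nabla Y X = bracket X Y := by
  ext i
  fin_cases i <;> simp [nabla_apply, bracket_apply] <;> ring

theorem nabla_dotProduct_add (X Y W : Fin 3 → ℝ) : nabla X Y ⬝ᵥ W + Y ⬝ᵥ nabla X W = 0 := by
  simp only [nabla_apply, Matrix.vec3_dotProduct, Matrix.cons_val]
  ring

theorem nabla_self_add_nabla_self_rotation (u v : ℝ) (X Y : Fin 3 → ℝ) :
    nabla (u • X + v • Y) (u • X + v • Y) + nabla (-v • X + u • Y) (-v • X + u • Y) =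
      (u ^ 2 + v ^ 2) • (nabla X X + nabla Y Y) := by
  ext i
  fin_cases i <;> simp [nabla_apply] <;> ring

theorem curvature_dotProduct (X Y : Fin 3 → ℝ) :
    curvature X Y X ⬝ᵥ Y =
      ((X ⬝ᵥ X) * (Y ⬝ᵥ Y) - (X ⬝ᵥ Y) ^ 2) / 4 - (X ⨯₃ Y) 2 ^ 2 := by
  simp only [curvature, nabla_apply, bracket_apply, Matrix.vec3_dotProduct, cross_apply,
    Pi.add_apply, Pi.sub_apply, Matrix.cons_val]
  ring

theorem sectionalCurvature_eq {X Y : Fin 3 → ℝ} (hXY : X ⨯₃ Y ≠ 0) :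
    sectionalCurvature X Y = 1 / 4 - (X ⨯₃ Y) 2 ^ 2 / (X ⨯₃ Y ⬝ᵥ X ⨯₃ Y) := by
  have area_ne : X ⨯₃ Y ⬝ᵥ X ⨯₃ Y ≠ 0 := mt dotProduct_self_eq_zero.1 hXY
  rw [sectionalCurvature, curvature_dotProduct, ← crossProduct_dotProduct_self]
  field_simp

theorem leftCoords_of_tangent (g : Nil) (X : Matrix (Fin 3) (Fin 3) ℝ) (h11 : X 1 1 = 0)
    (h21 : X 2 1 = 0) (h22 : X 2 2 = 0) :
    leftCoords g X = ![X 0 1, X 1 2, X 0 2 -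
      ((g : Matrix.SpecialLinearGroup (Fin 3) ℝ) : Matrix (Fin 3) (Fin 3) ℝ) 0 1 * X 1 2] := by
  obtain ⟨x, y, z, hg⟩ := g.2
  ext k
  simp only [leftCoords, coords_apply, Subgroup.coe_inv, Matrix.SpecialLinearGroup.coe_inv, hg,
    Matrix.adjugate_fin_three]
  fin_cases k <;> simp [Matrix.mul_apply, Fin.sum_univ_three, h11, h21, h22]
  ring

/-! ### Surfaces in a parameter -/

section Parameter

variable {M : Type*} [TopologicalSpace M]

/-- A matrix entry of the surface as a function of the parameter. -/
def entry (f : M → Nil) (c : OpenPartialHomeomorph M ℂ) (i j : Fin 3) (w : ℂ) : ℝ :=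
  ((f (c.symm w) : Matrix.SpecialLinearGroup (Fin 3) ℝ) : Matrix (Fin 3) (Fin 3) ℝ) i j

/-- The normal vector `∂_x f × ∂_y f`, translated to the unit and not normalized. -/
def normal (f : M → Nil) (c : OpenPartialHomeomorph M ℂ) (z : ℂ) : Fin 3 → ℝ :=
  leftDeriv f c 1 z ⨯₃ leftDeriv f c I z

/-- The vector `∇_{∂_x f} ∂_x f + ∇_{∂_y f} ∂_y f`, translated to the unit: in a conformal parameter
it is the tension field of `f` up to the conformal factor. -/
def tension (f : M → Nil) (c : OpenPartialHomeomorph M ℂ) (z : ℂ) : Fin 3 → ℝ :=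
  covDeriv f c 1 1 z + covDeriv f c I I z

/-- The coordinate `N₃ = ⟨N, e₃⟩` of the unit normal `N`, for a conformal parameter, where the
normal vector `∂_x f × ∂_y f` has length `e^{2α}`. -/
def normalThird (f : M → Nil) (c : OpenPartialHomeomorph M ℂ) (z : ℂ) : ℝ :=
  normal f c z 2 / firstForm f c 1 1 z

/-- The vector `∂_x (f⁻¹ ∂_x f) + ∂_y (f⁻¹ ∂_y f)`, the part of the tension that is linear in the
second derivatives of `f`. -/
def divLeftDeriv (f : M → Nil) (c : OpenPartialHomeomorph M ℂ) (z : ℂ) (k : Fin 3) : ℝ :=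
  fderiv ℝ (leftDeriv f c 1 · k) z 1 + fderiv ℝ (leftDeriv f c I · k) z I

/-- The surface is a smooth function of the parameter `c`. -/
def IsSmoothParam (f : M → Nil) (c : OpenPartialHomeomorph M ℂ) : Prop :=
  ∀ i j, ContDiffOn ℝ ∞ (entry f c i j) c.target

/-- The surface is a smooth conformal immersion as a function of the parameter `c`. -/
structure IsConformalParam (f : M → Nil) (c : OpenPartialHomeomorph M ℂ) : Prop where
  smooth : IsSmoothParam f c
  firstForm_pos : ∀ z ∈ c.target, 0 < firstForm f c 1 1 z
  firstForm_I_I : ∀ z ∈ c.target, firstForm f c I I z = firstForm f c 1 1 z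
  firstForm_one_I : ∀ z ∈ c.target, firstForm f c 1 I z = 0

variable {f : M → Nil} {c : OpenPartialHomeomorph M ℂ} {z : ℂ}

theorem dirDeriv_apply (f : M → Nil) (c : OpenPartialHomeomorph M ℂ) (v z : ℂ) (i j : Fin 3) :
    dirDeriv f c v z i j = fderiv ℝ (entry f c i j) z v := rfl

theorem leftDeriv_eq (f : M → Nil) (c : OpenPartialHomeomorph M ℂ) (v z : ℂ) :
    leftDeriv f c v z = ![fderiv ℝ (entry f c 0 1) z v, fderiv ℝ (entry f c 1 2) z v,
      fderiv ℝ (entry f c 0 2) z v - entry f c 0 1 z * fderiv ℝ (entry f c 1 2) z v] := by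
  have fixed_entry {i j : Fin 3} (r : ℝ) (h : ∀ w, entry f c i j w = r) :
      dirDeriv f c v z i j = 0 := by
    rw [dirDeriv_apply, funext h, fderiv_fun_const, Pi.zero_apply, zero_apply]
  have entry_eq (w : ℂ) : ∃ x y t : ℝ, ∀ i j,
      entry f c i j w = !![1, x, t; 0, 1, y; 0, 0, 1] i j := by
    obtain ⟨x, y, t, hg⟩ := (f (c.symm w)).2
    exact ⟨x, y, t, fun i j => congrFun₂ hg i j⟩
  refine leftCoords_of_tangent _ _ (fixed_entry 1 ?_) (fixed_entry 0 ?_) (fixed_entry 1 ?_) <;>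
  · intro w
    obtain ⟨x, y, t, h⟩ := entry_eq w
    simp [h]

theorem leftDeriv_eq_re_smul_add_im_smul (f : M → Nil) (c : OpenPartialHomeomorph M ℂ) (v z : ℂ) :
    leftDeriv f c v z = v.re • leftDeriv f c 1 z + v.im • leftDeriv f c I z := by
  ext k
  simp only [leftDeriv_eq, map_eq_re_smul_add_im_smul _ v]
  fin_cases k <;> simp
  ring

theorem firstForm_eq (f : M → Nil) (c : OpenPartialHomeomorph M ℂ) (v w z : ℂ) :
    firstForm f c v w z = leftDeriv f c v z ⬝ᵥ leftDeriv f c w z := rfl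

theorem firstFormDet_eq_normal_dotProduct (f : M → Nil) (c : OpenPartialHomeomorph M ℂ) (z : ℂ) :
    firstFormDet f c z = normal f c z ⬝ᵥ normal f c z :=
  (crossProduct_dotProduct_self _ _).symm

/-! ### Mean and sectional curvature in a conformal parameter -/

namespace IsConformalParam

theorem firstFormDet_eq (hc : IsConformalParam f c) (hz : z ∈ c.target) :
    firstFormDet f c z = firstForm f c 1 1 z ^ 2 := by
  rw [firstFormDet, hc.firstForm_I_I z hz, hc.firstForm_one_I z hz]
  ring

theorem sqrt_firstFormDet (hc : IsConformalParam f c) (hz : z ∈ c.target) :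
    √(firstFormDet f c z) = firstForm f c 1 1 z := by
  rw [hc.firstFormDet_eq hz, Real.sqrt_sq (hc.firstForm_pos z hz).le]

theorem normal_dotProduct_normal (hc : IsConformalParam f c) (hz : z ∈ c.target) :
    normal f c z ⬝ᵥ normal f c z = firstForm f c 1 1 z ^ 2 := by
  rw [← firstFormDet_eq_normal_dotProduct, hc.firstFormDet_eq hz]

theorem meanCurvatureIn_eq (hc : IsConformalParam f c) (hz : z ∈ c.target) :
    meanCurvatureIn f c z =
      tension f c z ⬝ᵥ normal f c z / (2 * firstForm f c 1 1 z ^ 2) := by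
  have hE := hc.firstForm_pos z hz
  have unitNormal_eq : unitNormal f c z = (firstForm f c 1 1 z)⁻¹ • normal f c z := by
    rw [unitNormal, ← normal, hc.normal_dotProduct_normal hz, Real.sqrt_sq hE.le]
  rw [meanCurvatureIn, hc.firstFormDet_eq hz, hc.firstForm_I_I z hz, hc.firstForm_one_I z hz]
  simp only [secondForm, unitNormal_eq, tension, add_dotProduct, dotProduct_smul, smul_eq_mul]
  field_simp
  ring

theorem sectionalCurvature_eq (hc : IsConformalParam f c) (hz : z ∈ c.target) :
    sectionalCurvature (leftDeriv f c 1 z) (leftDeriv f c I z) =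
      1 / 4 - normalThird f c z ^ 2 := by
  have normal_sq := hc.normal_dotProduct_normal hz
  have normal_ne : normal f c z ≠ 0 := by
    rw [Ne, ← dotProduct_self_eq_zero, normal_sq]
    exact pow_ne_zero 2 (hc.firstForm_pos z hz).ne'
  rw [Nil.sectionalCurvature_eq normal_ne, ← normal, normal_sq, normalThird, div_pow]

end IsConformalParam

/-! ### The structure equations -/

namespace IsSmoothParam

theorem contDiffOn_leftDeriv (hs : IsSmoothParam f c) (v : ℂ) (k : Fin 3) :
    ContDiffOn ℝ ∞ (leftDeriv f c v · k) c.target := by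
  have h := fun i j => contDiffOn_fderiv_apply (m := ∞) c.open_target (hs i j) (by simp) v
  simp only [leftDeriv_eq]
  fin_cases k
  · exact h 0 1
  · exact h 1 2
  · exact (h 0 2).sub ((hs 0 1).mul (h 1 2))

theorem differentiableAt_leftDeriv (hs : IsSmoothParam f c) (hz : z ∈ c.target) (v : ℂ)
    (k : Fin 3) : DifferentiableAt ℝ (leftDeriv f c v · k) z :=
  ((hs.contDiffOn_leftDeriv v k).differentiableOn (by simp)).differentiableAt
    (c.open_target.mem_nhds hz)

/-- The Maurer-Cartan equation `dθ + [θ, θ] / 2 = 0` for the form `θ = f⁻¹ df`. -/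
theorem maurerCartan (hs : IsSmoothParam f c) (hz : z ∈ c.target) (v w : ℂ) (k : Fin 3) :
    fderiv ℝ (leftDeriv f c w · k) z v + bracket (leftDeriv f c v z) (leftDeriv f c w z) k =
      fderiv ℝ (leftDeriv f c v · k) z w := by
  have hnhds := c.open_target.mem_nhds hz
  have comm (i j : Fin 3) := fderiv_fderiv_apply_comm ((hs i j).contDiffAt hnhds)
    (by simp only [minSmoothness_of_isRCLikeNormedField]; exact WithTop.coe_le_coe.2 le_top) v w
  have hx : DifferentiableAt ℝ (entry f c 0 1) z :=
    ((hs 0 1).contDiffAt hnhds).differentiableAt (by simp)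
  have hd (i j : Fin 3) (u : ℂ) : DifferentiableAt ℝ (fderiv ℝ (entry f c i j) · u) z :=
    ((contDiffOn_fderiv_apply (m := 1) c.open_target (hs i j)
      (WithTop.coe_le_coe.2 le_top) u).differentiableOn one_ne_zero).differentiableAt hnhds
  have third (u t : ℂ) : fderiv ℝ (fun ζ => fderiv ℝ (entry f c 0 2) ζ u -
      entry f c 0 1 ζ * fderiv ℝ (entry f c 1 2) ζ u) z t =
      fderiv ℝ (fderiv ℝ (entry f c 0 2) · u) z t -
      (entry f c 0 1 z * fderiv ℝ (fderiv ℝ (entry f c 1 2) · u) z t +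
        fderiv ℝ (entry f c 1 2) z u * fderiv ℝ (entry f c 0 1) z t) := by
    rw [fderiv_fun_sub (hd 0 2 u) (hx.fun_mul (hd 1 2 u)), fderiv_fun_mul hx (hd 1 2 u)]
    rfl
  simp only [bracket_apply, leftDeriv_eq]
  fin_cases k
  · simp [comm 0 1]
  · simp [comm 1 2]
  · simp only [Fin.reduceFinMk, Matrix.cons_val, third, comm 0 2, comm 1 2]
    ring

theorem covDeriv_comm (hs : IsSmoothParam f c) (hz : z ∈ c.target) (v w : ℂ) :
    covDeriv f c v w z = covDeriv f c w v z := by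
  ext k
  have torsion_free := congrFun (nabla_sub_nabla (leftDeriv f c v z) (leftDeriv f c w z)) k
  simp only [Pi.sub_apply] at torsion_free
  simp only [covDeriv]
  linarith [hs.maurerCartan hz v w k]

theorem fderiv_firstForm (hs : IsSmoothParam f c) (hz : z ∈ c.target) (u v w : ℂ) :
    fderiv ℝ (firstForm f c v w) z u =
      covDeriv f c u v z ⬝ᵥ leftDeriv f c w z + leftDeriv f c v z ⬝ᵥ covDeriv f c u w z := by
  have hd := hs.differentiableAt_leftDeriv hz
  have frame_derivative : fderiv ℝ (firstForm f c v w) z u =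
      (fun k => fderiv ℝ (leftDeriv f c v · k) z u) ⬝ᵥ leftDeriv f c w z +
        leftDeriv f c v z ⬝ᵥ fun k => fderiv ℝ (leftDeriv f c w · k) z u := by
    change fderiv ℝ (fun ζ => ∑ k, leftDeriv f c v ζ k * leftDeriv f c w ζ k) z u = _
    rw [fderiv_fun_sum fun k _ => (hd v k).fun_mul (hd w k)]
    simp only [dotProduct, sum_apply, ← Finset.sum_add_distrib]
    refine Finset.sum_congr rfl fun k _ => ?_
    rw [fderiv_fun_mul (hd v k) (hd w k)]
    simp
    ring
  have covDeriv_eq (t : ℂ) : covDeriv f c u t z =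
      (fun k => fderiv ℝ (leftDeriv f c t · k) z u) +
        nabla (leftDeriv f c u z) (leftDeriv f c t z) := rfl
  rw [frame_derivative, covDeriv_eq, covDeriv_eq, add_dotProduct, dotProduct_add]
  linarith [nabla_dotProduct_add (leftDeriv f c u z) (leftDeriv f c v z) (leftDeriv f c w z)]

end IsSmoothParam

namespace IsConformalParam

/-- With `E = G` and `F = 0`, `⟨∇_x ∂_x f, ∂_x f⟩ = E_x / 2` while
`⟨∇_y ∂_y f, ∂_x f⟩ = -⟨∂_y f, ∇_x ∂_y f⟩ = -G_x / 2`, and likewise for `∂_y f`. -/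
theorem tension_dotProduct_leftDeriv (hc : IsConformalParam f c) (hz : z ∈ c.target) :
    tension f c z ⬝ᵥ leftDeriv f c 1 z = 0 ∧ tension f c z ⬝ᵥ leftDeriv f c I z = 0 := by
  have hnhds := c.open_target.mem_nhds hz
  have fderiv_G (u : ℂ) :
      fderiv ℝ (firstForm f c I I) z u = fderiv ℝ (firstForm f c 1 1) z u := by
    rw [EventuallyEq.fderiv_eq (eventually_of_mem hnhds hc.firstForm_I_I)]
  have fderiv_F (u : ℂ) : fderiv ℝ (firstForm f c 1 I) z u = 0 := by
    rw [EventuallyEq.fderiv_eq (f := fun _ => 0) (eventually_of_mem hnhds hc.firstForm_one_I)]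
    simp
  simp only [hc.smooth.fderiv_firstForm hz, dotProduct_comm (leftDeriv f c 1 z),
    dotProduct_comm (leftDeriv f c I z)] at fderiv_G fderiv_F
  have G_x := fderiv_G 1
  have G_y := fderiv_G I
  have F_x := fderiv_F 1
  have F_y := fderiv_F I
  simp only [hc.smooth.covDeriv_comm hz I 1] at G_x G_y F_x F_y
  simp only [tension, add_dotProduct]
  constructor <;> linarith

theorem tension_eq (hc : IsConformalParam f c) (hz : z ∈ c.target) :
    tension f c z = (2 * meanCurvatureIn f c z) • normal f c z := by
  have hE := hc.firstForm_pos z hz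
  obtain ⟨orthogonal_x, orthogonal_y⟩ := hc.tension_dotProduct_leftDeriv hz
  have key : firstForm f c 1 1 z ^ 2 • tension f c z =
      (tension f c z ⬝ᵥ normal f c z) • normal f c z := by
    rw [← hc.normal_dotProduct_normal hz]
    exact dotProduct_self_smul_eq_smul_crossProduct orthogonal_x orthogonal_y
  calc tension f c z = (firstForm f c 1 1 z ^ 2)⁻¹ • firstForm f c 1 1 z ^ 2 • tension f c z :=
        (inv_smul_smul₀ (pow_ne_zero 2 hE.ne') _).symm
    _ = (2 * meanCurvatureIn f c z) • normal f c z := by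
        rw [key, smul_smul, hc.meanCurvatureIn_eq hz]
        congr 1
        field_simp

end IsConformalParam

/-! ### The Wirtinger derivative of `Z` -/

theorem tension_apply (f : M → Nil) (c : OpenPartialHomeomorph M ℂ) (z : ℂ) (k : Fin 3) :
    tension f c z k = divLeftDeriv f c z k + (nabla (leftDeriv f c 1 z) (leftDeriv f c 1 z) +
      nabla (leftDeriv f c I z) (leftDeriv f c I z)) k := by
  simp only [tension, covDeriv, divLeftDeriv, Pi.add_apply]
  ring

theorem IsSmoothParam.contDiffOn_Zcomp (hs : IsSmoothParam f c) (k : Fin 3) :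
    ContDiffOn ℝ ∞ (Zcomp f c k) c.target := by
  have h (v : ℂ) := Complex.ofRealCLM.contDiff.comp_contDiffOn (hs.contDiffOn_leftDeriv v k)
  exact ((h 1).sub (contDiffOn_const.mul (h I))).div_const 2

theorem IsSmoothParam.differentiableAt_Zcomp (hs : IsSmoothParam f c) (hz : z ∈ c.target)
    (k : Fin 3) : DifferentiableAt ℝ (Zcomp f c k) z :=
  ((hs.contDiffOn_Zcomp k).differentiableOn (by simp)).differentiableAt
    (c.open_target.mem_nhds hz)

theorem IsSmoothParam.fderiv_Zcomp (hs : IsSmoothParam f c) (hz : z ∈ c.target) (k : Fin 3)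
    (u : ℂ) : fderiv ℝ (Zcomp f c k) z u =
      (fderiv ℝ (leftDeriv f c 1 · k) z u - I * fderiv ℝ (leftDeriv f c I · k) z u) / 2 := by
  have hd (v : ℂ) := Complex.ofRealCLM.hasFDerivAt.comp z
    (hs.differentiableAt_leftDeriv hz v k).hasFDerivAt
  have hZ := (((hd 1).sub ((hd I).const_mul I)).const_mul 2⁻¹).congr_of_eventuallyEq
    (f₁ := Zcomp f c k) (.of_forall fun ζ => div_eq_inv_mul _ _)
  rw [hZ.fderiv]
  simp [div_eq_inv_mul]

theorem IsSmoothParam.four_mul_dzbar_Zcomp (hs : IsSmoothParam f c) (hz : z ∈ c.target)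
    (k : Fin 3) : 4 * dzbar (Zcomp f c k) z = divLeftDeriv f c z k +
      I * (bracket (leftDeriv f c 1 z) (leftDeriv f c I z) k : ℝ) := by
  rw [dzbar, hs.fderiv_Zcomp hz, hs.fderiv_Zcomp hz, divLeftDeriv,
    eq_sub_of_add_eq' (hs.maurerCartan hz 1 I k)]
  push_cast
  linear_combination -(fderiv ℝ (leftDeriv f c I · k) z I : ℂ) * Complex.I_sq

end Parameter

/-! ### Wirtinger calculus -/

section Wirtinger

variable {g h φ : ℂ → ℂ} {z : ℂ}

theorem dzbar_congr (hgh : g =ᶠ[𝓝 z] h) : dzbar g z = dzbar h z := by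
  rw [dzbar, dzbar, hgh.fderiv_eq]

theorem dz_congr (hgh : g =ᶠ[𝓝 z] h) : dz g z = dz h z := by
  rw [dz, dz, hgh.fderiv_eq]

theorem dzbar_add (hg : DifferentiableAt ℝ g z) (hh : DifferentiableAt ℝ h z) :
    dzbar (fun ζ => g ζ + h ζ) z = dzbar g z + dzbar h z := by
  simp only [dzbar, fderiv_fun_add hg hh, add_apply]
  ring

theorem dzbar_sub (hg : DifferentiableAt ℝ g z) (hh : DifferentiableAt ℝ h z) :
    dzbar (fun ζ => g ζ - h ζ) z = dzbar g z - dzbar h z := by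
  simp only [dzbar, fderiv_fun_sub hg hh, sub_apply]
  ring

theorem dzbar_mul (hg : DifferentiableAt ℝ g z) (hh : DifferentiableAt ℝ h z) :
    dzbar (fun ζ => g ζ * h ζ) z = g z * dzbar h z + h z * dzbar g z := by
  simp only [dzbar, fderiv_fun_mul hg hh, add_apply, smul_apply, smul_eq_mul]
  ring

theorem dzbar_sq (hg : DifferentiableAt ℝ g z) :
    dzbar (fun ζ => g ζ ^ 2) z = 2 * (g z * dzbar g z) := by
  simp only [sq, dzbar_mul hg hg, two_mul]

theorem dzbar_const_mul (w : ℂ) (hg : DifferentiableAt ℝ g z) :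
    dzbar (fun ζ => w * g ζ) z = w * dzbar g z := by
  simp only [dzbar, fderiv_const_mul hg, smul_apply, smul_eq_mul]
  ring

theorem dzbar_star (hg : DifferentiableAt ℝ g z) :
    dzbar (fun ζ => star (g ζ)) z = star (dz g z) := by
  have h : HasFDerivAt (fun ζ => star (g ζ))
      ((Complex.conjCLE : ℂ →L[ℝ] ℂ) ∘L fderiv ℝ g z) z :=
    (Complex.conjCLE : ℂ →L[ℝ] ℂ).hasFDerivAt.comp z hg.hasFDerivAt
  rw [dzbar, h.fderiv, dz]
  simp

theorem dzbar_comp_holomorphic (hg : DifferentiableAt ℝ g (φ z)) (hφ : DifferentiableAt ℂ φ z) :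
    dzbar (fun ζ => g (φ ζ)) z = star (deriv φ z) * dzbar g (φ z) := by
  have chain := fderiv_comp_restrictScalars hg hφ
  simp only [Function.comp_def] at chain
  rw [dzbar, dzbar, chain, chain, map_eq_re_smul_add_im_smul _ (deriv φ z * 1),
    map_eq_re_smul_add_im_smul _ (deriv φ z * I)]
  apply Complex.ext <;> simp <;> ring

theorem dzbar_holomorphic (hh : DifferentiableAt ℂ h z) : dzbar h z = 0 := by
  have chain := fderiv_comp_restrictScalars (𝕜 := ℝ) (g := id) differentiableAt_id hh
  simp only [Function.id_comp, fderiv_id, ContinuousLinearMap.id_apply] at chain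
  rw [dzbar, chain, chain]
  linear_combination deriv h z / 2 * Complex.I_sq

theorem dzbar_holomorphic_mul_comp (hh : DifferentiableAt ℂ h z)
    (hg : DifferentiableAt ℝ g (φ z)) (hφ : DifferentiableAt ℂ φ z) :
    dzbar (fun ζ => h ζ * g (φ ζ)) z = h z * star (deriv φ z) * dzbar g (φ z) := by
  have hgφ : DifferentiableAt ℝ (fun ζ => g (φ ζ)) z := hg.comp z (hφ.restrictScalars ℝ)
  rw [dzbar_mul (hh.restrictScalars ℝ) hgφ, dzbar_comp_holomorphic hg hφ, dzbar_holomorphic hh]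
  ring

end Wirtinger

/-! ### Holomorphic changes of the parameter -/

section Change

variable {M : Type*} [TopologicalSpace M] {f : M → Nil} {c c' : OpenPartialHomeomorph M ℂ}
  {φ : ℂ → ℂ} {z : ℂ}

/-- Near the value `z` of the parameter `c`, the function `φ` is a biholomorphic change from the
parameter `c` to the parameter `c'`. -/
structure IsHolomorphicChange (c c' : OpenPartialHomeomorph M ℂ) (φ : ℂ → ℂ) (z : ℂ) : Prop where
  mem_target : z ∈ c.target
  map_mem_target : φ z ∈ c'.target
  analyticAt : AnalyticAt ℂ φ z
  deriv_ne_zero : deriv φ z ≠ 0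
  symm_eventuallyEq : c.symm =ᶠ[𝓝 z] c'.symm ∘ φ

theorem IsConformalParam.firstForm_eq_re_mul (hc : IsConformalParam f c) (hz : z ∈ c.target)
    (v w : ℂ) : firstForm f c v w z = (v * star w).re * firstForm f c 1 1 z := by
  have G_eq := hc.firstForm_I_I z hz
  have F_eq := hc.firstForm_one_I z hz
  simp only [firstForm_eq] at G_eq F_eq ⊢
  rw [leftDeriv_eq_re_smul_add_im_smul f c v, leftDeriv_eq_re_smul_add_im_smul f c w]
  simp only [add_dotProduct, dotProduct_add, smul_dotProduct, dotProduct_smul,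
    dotProduct_comm (leftDeriv f c I z) (leftDeriv f c 1 z), G_eq, F_eq]
  simp
  ring

namespace IsHolomorphicChange

protected theorem eventually (h : IsHolomorphicChange c c' φ z) :
    ∀ᶠ ζ in 𝓝 z, IsHolomorphicChange c c' φ ζ := by
  filter_upwards [c.open_target.mem_nhds h.mem_target,
    h.analyticAt.continuousAt.preimage_mem_nhds (c'.open_target.mem_nhds h.map_mem_target),
    h.analyticAt.eventually_analyticAt,
    h.analyticAt.deriv.continuousAt.eventually_ne h.deriv_ne_zero,
    h.symm_eventuallyEq.eventuallyEq_nhds] with ζ h₁ h₂ h₃ h₄ h₅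
  exact ⟨h₁, h₂, h₃, h₄, h₅⟩

theorem leftDeriv_eq (h : IsHolomorphicChange c c' φ z) (hs : IsSmoothParam f c') (v : ℂ) :
    leftDeriv f c v z = leftDeriv f c' (deriv φ z * v) (φ z) := by
  have entry_eq (i j : Fin 3) : entry f c i j =ᶠ[𝓝 z] entry f c' i j ∘ φ := by
    filter_upwards [h.symm_eventuallyEq] with ζ hζ
    simp only [entry, hζ, Function.comp_apply]
  have fderiv_entry_eq (i j : Fin 3) : fderiv ℝ (entry f c i j) z v =
      fderiv ℝ (entry f c' i j) (φ z) (deriv φ z * v) := by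
    have hd : DifferentiableAt ℝ (entry f c' i j) (φ z) :=
      ((hs i j).differentiableOn (by simp)).differentiableAt
        (c'.open_target.mem_nhds h.map_mem_target)
    rw [(entry_eq i j).fderiv_eq, fderiv_comp_restrictScalars hd h.analyticAt.differentiableAt]
  rw [Nil.leftDeriv_eq, Nil.leftDeriv_eq, fderiv_entry_eq, fderiv_entry_eq, fderiv_entry_eq,
    (entry_eq 0 1).eq_of_nhds, Function.comp_apply]

theorem leftDeriv_one_eq (h : IsHolomorphicChange c c' φ z) (hs : IsSmoothParam f c') :
    leftDeriv f c 1 z =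
      (deriv φ z).re • leftDeriv f c' 1 (φ z) + (deriv φ z).im • leftDeriv f c' I (φ z) := by
  rw [h.leftDeriv_eq hs, mul_one, leftDeriv_eq_re_smul_add_im_smul]

theorem leftDeriv_I_eq (h : IsHolomorphicChange c c' φ z) (hs : IsSmoothParam f c') :
    leftDeriv f c I z =
      -(deriv φ z).im • leftDeriv f c' 1 (φ z) + (deriv φ z).re • leftDeriv f c' I (φ z) := by
  rw [h.leftDeriv_eq hs, leftDeriv_eq_re_smul_add_im_smul]
  simp

theorem firstForm_eq (h : IsHolomorphicChange c c' φ z) (hc : IsConformalParam f c') (v w : ℂ) :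
    firstForm f c v w z =
      (v * star w).re * (Complex.normSq (deriv φ z) * firstForm f c' 1 1 (φ z)) := by
  rw [Nil.firstForm_eq, h.leftDeriv_eq hc.smooth, h.leftDeriv_eq hc.smooth, ← Nil.firstForm_eq,
    hc.firstForm_eq_re_mul h.map_mem_target, ← mul_assoc]
  congr 1
  simp only [Complex.normSq_apply, Complex.mul_re, Complex.mul_im, Complex.star_def,
    Complex.conj_re, Complex.conj_im, map_mul]
  ring

theorem firstForm_one_one_eq (h : IsHolomorphicChange c c' φ z) (hc : IsConformalParam f c') :
    firstForm f c 1 1 z = Complex.normSq (deriv φ z) * firstForm f c' 1 1 (φ z) := by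
  simp [h.firstForm_eq hc]

theorem normal_eq (h : IsHolomorphicChange c c' φ z) (hs : IsSmoothParam f c') :
    normal f c z = Complex.normSq (deriv φ z) • normal f c' (φ z) := by
  rw [normal, h.leftDeriv_one_eq hs, h.leftDeriv_I_eq hs, crossProduct_rotation, ← normal,
    Complex.normSq_apply, sq, sq]

theorem Zcomp_eq (h : IsHolomorphicChange c c' φ z) (hs : IsSmoothParam f c') (k : Fin 3) :
    Zcomp f c k z = deriv φ z * Zcomp f c' k (φ z) := by
  rw [Zcomp, h.leftDeriv_one_eq hs, h.leftDeriv_I_eq hs, Zcomp]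
  apply Complex.ext <;> simp <;> ring

theorem divLeftDeriv_eq (h : IsHolomorphicChange c c' φ z) (hs : IsSmoothParam f c)
    (hs' : IsSmoothParam f c') (k : Fin 3) :
    divLeftDeriv f c z k = Complex.normSq (deriv φ z) * divLeftDeriv f c' (φ z) k := by
  have dzbar_eq : dzbar (Zcomp f c k) z =
      Complex.normSq (deriv φ z) * dzbar (Zcomp f c' k) (φ z) := by
    rw [dzbar_congr (h.eventually.mono fun ζ hζ => hζ.Zcomp_eq hs' k),
      dzbar_holomorphic_mul_comp h.analyticAt.deriv.differentiableAt
        (hs'.differentiableAt_Zcomp h.map_mem_target k) h.analyticAt.differentiableAt]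
    exact congrArg (· * _) (Complex.mul_conj _)
  have re_four_mul_dzbar := congrArg (fun w => (4 * w).re) dzbar_eq
  simp only [mul_left_comm (4 : ℂ), hs.four_mul_dzbar_Zcomp h.mem_target,
    hs'.four_mul_dzbar_Zcomp h.map_mem_target] at re_four_mul_dzbar
  simpa using re_four_mul_dzbar

theorem tension_eq (h : IsHolomorphicChange c c' φ z) (hs : IsSmoothParam f c)
    (hs' : IsSmoothParam f c') :
    tension f c z = Complex.normSq (deriv φ z) • tension f c' (φ z) := by
  ext k
  rw [Pi.smul_apply, tension_apply, tension_apply, h.divLeftDeriv_eq hs hs',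
    h.leftDeriv_one_eq hs', h.leftDeriv_I_eq hs', nabla_self_add_nabla_self_rotation,
    Complex.normSq_apply, Pi.smul_apply, smul_eq_mul, smul_eq_mul]
  ring

theorem isConformalAt (h : IsHolomorphicChange c c' φ z) (hc : IsConformalParam f c') :
    0 < firstForm f c 1 1 z ∧ firstForm f c I I z = firstForm f c 1 1 z ∧
      firstForm f c 1 I z = 0 := by
  have hE := hc.firstForm_pos _ h.map_mem_target
  rw [h.firstForm_eq hc, h.firstForm_eq hc, h.firstForm_eq hc]
  simp [hE, h.deriv_ne_zero]

theorem meanCurvatureIn_eq (h : IsHolomorphicChange c c' φ z) (hc : IsConformalParam f c)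
    (hc' : IsConformalParam f c') : meanCurvatureIn f c z = meanCurvatureIn f c' (φ z) := by
  have normSq_pos := Complex.normSq_pos.2 h.deriv_ne_zero
  rw [hc.meanCurvatureIn_eq h.mem_target, hc'.meanCurvatureIn_eq h.map_mem_target,
    h.tension_eq hc.smooth hc'.smooth, h.normal_eq hc'.smooth, h.firstForm_one_one_eq hc',
    smul_dotProduct, dotProduct_smul, smul_eq_mul, smul_eq_mul]
  field_simp

theorem normalThird_eq (h : IsHolomorphicChange c c' φ z) (hc : IsConformalParam f c') :
    normalThird f c z = normalThird f c' (φ z) := by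
  rw [normalThird, h.normal_eq hc.smooth, h.firstForm_one_one_eq hc, Pi.smul_apply, smul_eq_mul,
    mul_div_mul_left _ _ (Complex.normSq_pos.2 h.deriv_ne_zero).ne', ← normalThird]

end IsHolomorphicChange

/-! ### Continuity in a parameter -/

theorem IsSmoothParam.continuousOn_leftDeriv (hs : IsSmoothParam f c) (v : ℂ) :
    ContinuousOn (leftDeriv f c v) c.target :=
  continuousOn_pi.2 fun k => (hs.contDiffOn_leftDeriv v k).continuousOn

theorem IsSmoothParam.continuousOn_firstForm (hs : IsSmoothParam f c) (v w : ℂ) :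
    ContinuousOn (firstForm f c v w) c.target :=
  ((continuous_fst.dotProduct continuous_snd).comp_continuousOn
    ((hs.continuousOn_leftDeriv v).prodMk (hs.continuousOn_leftDeriv w))).congr
      fun z _ => firstForm_eq f c v w z

theorem IsSmoothParam.continuousOn_normal (hs : IsSmoothParam f c) :
    ContinuousOn (normal f c) c.target := by
  have continuous_cross : Continuous fun p : (Fin 3 → ℝ) × (Fin 3 → ℝ) => p.1 ⨯₃ p.2 := by
    simp only [cross_apply]
    fun_prop
  exact continuous_cross.comp_continuousOn
    ((hs.continuousOn_leftDeriv 1).prodMk (hs.continuousOn_leftDeriv I))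

theorem IsSmoothParam.continuousOn_covDeriv (hs : IsSmoothParam f c) (v w : ℂ) :
    ContinuousOn (covDeriv f c v w) c.target := by
  have continuous_nabla : Continuous fun p : (Fin 3 → ℝ) × (Fin 3 → ℝ) => nabla p.1 p.2 := by
    unfold nabla
    fun_prop
  refine continuousOn_pi.2 fun k => ContinuousOn.add ?_ ?_
  · exact (contDiffOn_fderiv_apply (m := ∞) c.open_target (hs.contDiffOn_leftDeriv w k)
      (by simp) v).continuousOn
  · exact (continuous_apply k).comp_continuousOn (continuous_nabla.comp_continuousOn
      ((hs.continuousOn_leftDeriv v).prodMk (hs.continuousOn_leftDeriv w)))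

theorem IsConformalParam.continuousOn_meanCurvatureIn (hc : IsConformalParam f c) :
    ContinuousOn (meanCurvatureIn f c) c.target := by
  have continuousOn_tension : ContinuousOn (tension f c) c.target :=
    (hc.smooth.continuousOn_covDeriv 1 1).add (hc.smooth.continuousOn_covDeriv I I)
  have continuousOn_dotProduct : ContinuousOn (fun z => tension f c z ⬝ᵥ normal f c z) c.target :=
    (continuous_fst.dotProduct continuous_snd).comp_continuousOn
      (continuousOn_tension.prodMk hc.smooth.continuousOn_normal)
  refine (continuousOn_dotProduct.div (((hc.smooth.continuousOn_firstForm 1 1).pow 2).const_mul 2)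
    fun z hz => ?_).congr fun z hz => hc.meanCurvatureIn_eq hz
  exact mul_ne_zero two_ne_zero (pow_ne_zero 2 (hc.firstForm_pos z hz).ne')

theorem IsConformalParam.continuousOn_normalThird (hc : IsConformalParam f c) :
    ContinuousOn (normalThird f c) c.target :=
  ((continuousOn_pi.1 hc.smooth.continuousOn_normal 2).div
    (hc.smooth.continuousOn_firstForm 1 1) fun z hz => (hc.firstForm_pos z hz).ne')

end Change

/-! ### Invariants of a conformal immersion -/

section Invariants

variable {M : Type*} [TopologicalSpace M] [ChartedSpace ℂ M] {f : M → Nil}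
  {c c' : OpenPartialHomeomorph M ℂ}

theorem isHolomorphicChange_of_mem_maximalAtlas {z : ℂ}
    (hc : c ∈ IsManifold.maximalAtlas 𝓘(ℂ, ℂ) ω M)
    (hc' : c' ∈ IsManifold.maximalAtlas 𝓘(ℂ, ℂ) ω M)
    (hz : z ∈ c.target) (hz' : c.symm z ∈ c'.source) :
    IsHolomorphicChange c c' (c' ∘ c.symm) z := by
  have differentiableAt_change {e e' : OpenPartialHomeomorph M ℂ} {w : ℂ}
      (he : e ∈ IsManifold.maximalAtlas 𝓘(ℂ, ℂ) ω M)
      (he' : e' ∈ IsManifold.maximalAtlas 𝓘(ℂ, ℂ) ω M)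
      (hw : w ∈ (e.symm ≫ₕ e').source) : DifferentiableAt ℂ (e' ∘ e.symm) w :=
    ((contMDiffOn_iff_contDiffOn.1 (contMDiffOn_of_mem_contDiffGroupoid
      (IsManifold.compatible_of_mem_maximalAtlas he he'))).differentiableOn
        (by simp)).differentiableAt ((e.symm ≫ₕ e').open_source.mem_nhds hw)
  have mem_source : z ∈ (c.symm ≫ₕ c').source := ⟨hz, hz'⟩
  have source_mem_nhds := (c.symm ≫ₕ c').open_source.mem_nhds mem_source
  have symm_symm : c'.symm (c' (c.symm z)) = c.symm z := c'.left_inv hz'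
  have mem_source' : c' (c.symm z) ∈ (c'.symm ≫ₕ c).source :=
    ⟨c'.map_source hz', Set.mem_preimage.2 (symm_symm.symm ▸ c.map_target hz)⟩
  refine ⟨hz, c'.map_source hz', ?_, fun deriv_eq_zero => ?_, ?_⟩
  · exact DifferentiableOn.analyticAt
      (fun w hw => (differentiableAt_change hc hc' hw).differentiableWithinAt) source_mem_nhds
  · -- The change of parameters has a differentiable inverse.
    refine not_differentiableAt_of_local_left_inverse_hasDerivAt_zero
      (f := c' ∘ c.symm) (g := c ∘ c'.symm) (a := c' (c.symm z)) ?_ ?_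
      (differentiableAt_change hc' hc mem_source')
    · rw [← deriv_eq_zero, Function.comp_apply, symm_symm, c.right_inv hz]
      exact (differentiableAt_change hc hc' mem_source).hasDerivAt
    · filter_upwards [(c'.symm ≫ₕ c).open_source.mem_nhds mem_source'] with w hw
      exact (congrArg c' (c.left_inv hw.2)).trans (c'.right_inv hw.1)
  · filter_upwards [source_mem_nhds] with w hw
    exact (c'.left_inv hw.2).symm

theorem isHolomorphicChange_apply {p : M} (hc : c ∈ IsManifold.maximalAtlas 𝓘(ℂ, ℂ) ω M)
    (hc' : c' ∈ IsManifold.maximalAtlas 𝓘(ℂ, ℂ) ω M)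
    (hp : p ∈ c.source) (hp' : p ∈ c'.source) :
    IsHolomorphicChange c c' (c' ∘ c.symm) (c p) :=
  isHolomorphicChange_of_mem_maximalAtlas hc hc' (c.map_source hp)
    (by rwa [c.left_inv hp])

/-- The coordinate `N₃ = ⟨N, e₃⟩` of the unit normal at a point of the surface. -/
def normalThirdAt (f : M → Nil) (p : M) : ℝ :=
  normalThird f (chartAt ℂ p) (chartAt ℂ p p)

theorem IsConformalImmersion.isConformalParam_of_isSmoothParam (hf : IsConformalImmersion f)
    (hc : c ∈ atlas ℂ M) (hs : IsSmoothParam f c) : IsConformalParam f c where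
  smooth := hs
  firstForm_pos z hz := by
    have leftDeriv_ne_zero : leftDeriv f c 1 z ≠ 0 := (hf.immersion c hc z hz).ne_zero 0
    rw [firstForm_eq]
    exact (Finset.sum_nonneg fun i _ => mul_self_nonneg _).lt_of_ne'
      (mt dotProduct_self_eq_zero.1 leftDeriv_ne_zero)
  firstForm_I_I z hz := (hf.conformal c hc z hz).1.symm
  firstForm_one_I z hz := (hf.conformal c hc z hz).2

variable [IsManifold 𝓘(ℂ, ℂ) ω M]

variable (M) in
theorem isManifold_restrictScalars : IsManifold 𝓘(ℝ, ℂ) ∞ M where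
  compatible he he' :=
    contDiffGroupoid_le_restrictScalars (𝕜' := ℂ) le_top (StructureGroupoid.compatible _ he he')

theorem contDiffOn_comp_symm {g : M → ℝ} (hg : ContMDiff 𝓘(ℝ, ℂ) 𝓘(ℝ, ℝ) ∞ g)
    (hc : c ∈ IsManifold.maximalAtlas 𝓘(ℂ, ℂ) ω M) :
    ContDiffOn ℝ ∞ (g ∘ c.symm) c.target := by
  have := isManifold_restrictScalars M
  exact contMDiffOn_iff_contDiffOn.1 (hg.comp_contMDiffOn (contMDiffOn_symm_of_mem_maximalAtlas
    (StructureGroupoid.maximalAtlas_mono (contDiffGroupoid_le_restrictScalars le_top) hc)))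

namespace IsConformalImmersion

theorem isSmoothParam (hf : IsConformalImmersion f)
    (hc : c ∈ IsManifold.maximalAtlas 𝓘(ℂ, ℂ) ω M) : IsSmoothParam f c :=
  fun i j => contDiffOn_comp_symm (hf.smooth i j) hc

theorem isConformalParam (hf : IsConformalImmersion f)
    (hc : c ∈ IsManifold.maximalAtlas 𝓘(ℂ, ℂ) ω M) : IsConformalParam f c := by
  have conformal (z : ℂ) (hz : z ∈ c.target) : 0 < firstForm f c 1 1 z ∧
      firstForm f c I I z = firstForm f c 1 1 z ∧ firstForm f c 1 I z = 0 := by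
    have hc' := IsManifold.chart_mem_maximalAtlas (I := 𝓘(ℂ, ℂ)) (n := ω) (c.symm z)
    exact (isHolomorphicChange_of_mem_maximalAtlas hc hc' hz
      (mem_chart_source ℂ (c.symm z))).isConformalAt
        (hf.isConformalParam_of_isSmoothParam (chart_mem_atlas ℂ _) (hf.isSmoothParam hc'))
  exact ⟨hf.isSmoothParam hc, fun z hz => (conformal z hz).1, fun z hz => (conformal z hz).2.1,
    fun z hz => (conformal z hz).2.2⟩

theorem isConformalParam_chartAt (hf : IsConformalImmersion f) (p : M) :
    IsConformalParam f (chartAt ℂ p) :=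
  hf.isConformalParam (IsManifold.chart_mem_maximalAtlas p)

theorem meanCurvature_eq (hf : IsConformalImmersion f)
    (hc : c ∈ IsManifold.maximalAtlas 𝓘(ℂ, ℂ) ω M) {p : M} (hp : p ∈ c.source) :
    meanCurvature f p = meanCurvatureIn f c (c p) := by
  rw [meanCurvature, (isHolomorphicChange_apply (IsManifold.chart_mem_maximalAtlas p) hc
    (mem_chart_source ℂ p) hp).meanCurvatureIn_eq (hf.isConformalParam_chartAt p)
      (hf.isConformalParam hc), Function.comp_apply,
    (chartAt ℂ p).left_inv (mem_chart_source ℂ p)]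

theorem normalThirdAt_eq (hf : IsConformalImmersion f)
    (hc : c ∈ IsManifold.maximalAtlas 𝓘(ℂ, ℂ) ω M) {p : M} (hp : p ∈ c.source) :
    normalThirdAt f p = normalThird f c (c p) := by
  rw [normalThirdAt, (isHolomorphicChange_apply (IsManifold.chart_mem_maximalAtlas p) hc
    (mem_chart_source ℂ p) hp).normalThird_eq (hf.isConformalParam hc), Function.comp_apply,
    (chartAt ℂ p).left_inv (mem_chart_source ℂ p)]

theorem tangentCurvature_eq (hf : IsConformalImmersion f) (p : M) :
    tangentCurvature f p = 1 / 4 - normalThirdAt f p ^ 2 :=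
  (hf.isConformalParam_chartAt p).sectionalCurvature_eq (mem_chart_target ℂ p)

theorem continuous_meanCurvature (hf : IsConformalImmersion f) : Continuous (meanCurvature f) :=
  continuous_of_forall_chartAt
    (fun p => (hf.isConformalParam_chartAt p).continuousOn_meanCurvatureIn)
    fun p _ hq => hf.meanCurvature_eq (IsManifold.chart_mem_maximalAtlas p) hq

theorem continuous_normalThirdAt (hf : IsConformalImmersion f) : Continuous (normalThirdAt f) :=
  continuous_of_forall_chartAt
    (fun p => (hf.isConformalParam_chartAt p).continuousOn_normalThird)
    fun p _ hq => hf.normalThirdAt_eq (IsManifold.chart_mem_maximalAtlas p) hq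

end IsConformalImmersion

end Invariants

/-! ### The area measure -/

section Area

variable {M : Type*} [TopologicalSpace M] [MeasurableSpace M] {f : M → Nil}
  {c c' : OpenPartialHomeomorph M ℂ} {s : Set M}

theorem localArea_eq_map (f : M → Nil) (c : OpenPartialHomeomorph M ℂ) :
    localArea f c = ((volume.withDensity fun z =>
      ENNReal.ofReal (Real.sqrt (firstFormDet f c z))).restrict c.target).map c.symm := by
  rw [localArea, restrict_withDensity c.open_target.measurableSet]

variable [BorelSpace M]

theorem localArea_restrict_source (f : M → Nil) (c : OpenPartialHomeomorph M ℂ) :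
    (localArea f c).restrict c.source = localArea f c := by
  rw [localArea_eq_map, restrict_map_symm _ c.open_source.measurableSet subset_rfl,
    c.image_source_eq_target]

theorem aemeasurable_symm_withDensity (hs : MeasurableSet s) (hsc : s ⊆ c.source)
    (ρ : ℂ → ENNReal) : AEMeasurable c.symm ((volume.restrict (c '' s)).withDensity ρ) :=
  ((c.continuousOn_symm.mono (c.mapsTo.mono_left hsc).image_subset).aemeasurable
    (measurableSet_image_of_subset_source hs hsc)).mono_ac (withDensity_absolutelyContinuous _ _)

theorem IsSmoothParam.aemeasurable_firstForm (hf : IsSmoothParam f c) (hs : MeasurableSet s)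
    (hsc : s ⊆ c.source) :
    AEMeasurable (fun z => ENNReal.ofReal (firstForm f c 1 1 z)) (volume.restrict (c '' s)) :=
  (((hf.continuousOn_firstForm 1 1).mono (c.mapsTo.mono_left hsc).image_subset).aemeasurable
    (measurableSet_image_of_subset_source hs hsc)).ennreal_ofReal

namespace IsConformalParam

theorem localArea_restrict (hc : IsConformalParam f c) (hs : MeasurableSet s)
    (hsc : s ⊆ c.source) :
    (localArea f c).restrict s = ((volume.restrict (c '' s)).withDensity
      fun z => ENNReal.ofReal (firstForm f c 1 1 z)).map c.symm := by
  have measurableSet_image := measurableSet_image_of_subset_source hs hsc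
  rw [localArea_eq_map, restrict_map_symm _ hs hsc, restrict_withDensity measurableSet_image]
  congr 1
  refine withDensity_congr_ae ((ae_restrict_mem measurableSet_image).mono fun z hz => ?_)
  simp only [hc.sqrt_firstFormDet ((c.mapsTo.mono_left hsc).image_subset hz)]

theorem localArea_apply (hc : IsConformalParam f c) (hs : MeasurableSet s)
    (hsc : s ⊆ c.source) :
    localArea f c s = ∫⁻ z in c '' s, ENNReal.ofReal (firstForm f c 1 1 z) := by
  rw [← Measure.restrict_apply_univ, hc.localArea_restrict hs hsc,
    Measure.map_apply_of_aemeasurable (aemeasurable_symm_withDensity hs hsc _) .univ,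
    Set.preimage_univ, withDensity_apply _ .univ, Measure.restrict_univ]

theorem localArea_congr (hc : IsConformalParam f c) (hc' : IsConformalParam f c')
    (hs : MeasurableSet s) (hsc : s ⊆ c.source) (hsc' : s ⊆ c'.source)
    (change : ∀ p ∈ s, IsHolomorphicChange c c' (c' ∘ c.symm) (c p)) :
    localArea f c s = localArea f c' s := by
  have image_eq : c' '' s = (c' ∘ c.symm) '' (c '' s) := by
    rw [Set.image_image]
    exact Set.image_congr fun p hp => by rw [Function.comp_apply, c.left_inv (hsc hp)]
  have injOn : Set.InjOn (c' ∘ c.symm) (c '' s) := by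
    refine c'.injOn.comp (c.symm.injOn.mono (c.mapsTo.mono_left hsc).image_subset) ?_
    rintro _ ⟨p, hp, rfl⟩
    exact (c.left_inv (hsc hp)).symm ▸ hsc' hp
  rw [hc.localArea_apply hs hsc, hc'.localArea_apply hs hsc', image_eq,
    lintegral_image_eq_lintegral_abs_det_fderiv_mul volume
      (measurableSet_image_of_subset_source hs hsc) (f' := fun z =>
        (ContinuousLinearMap.toSpanSingleton ℂ (deriv (c' ∘ c.symm) z)).restrictScalars ℝ) ?_ injOn]
  · refine setLIntegral_congr_fun (measurableSet_image_of_subset_source hs hsc) ?_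
    rintro _ ⟨p, hp, rfl⟩
    simp only [det_restrictScalars_toSpanSingleton, abs_of_nonneg (Complex.normSq_nonneg _),
      (change p hp).firstForm_one_one_eq hc', ENNReal.ofReal_mul (Complex.normSq_nonneg _)]
  · rintro _ ⟨p, hp, rfl⟩
    exact ((change p hp).analyticAt.differentiableAt.hasDerivAt.hasFDerivAt.restrictScalars
      ℝ).hasFDerivWithinAt

end IsConformalParam

namespace IsConformalImmersion

variable [ChartedSpace ℂ M] [IsManifold 𝓘(ℂ, ℂ) ω M]

theorem localArea_restrict_comm (hf : IsConformalImmersion f)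
    (hc : c ∈ IsManifold.maximalAtlas 𝓘(ℂ, ℂ) ω M)
    (hc' : c' ∈ IsManifold.maximalAtlas 𝓘(ℂ, ℂ) ω M) :
    (localArea f c').restrict c.source = (localArea f c).restrict c'.source := by
  ext s hs
  rw [← localArea_restrict_source f c', ← localArea_restrict_source f c,
    Measure.restrict_restrict c.open_source.measurableSet,
    Measure.restrict_restrict c'.open_source.measurableSet, Measure.restrict_apply hs,
    Measure.restrict_apply hs, Set.inter_comm c'.source]
  exact ((hf.isConformalParam hc).localArea_congr (hf.isConformalParam hc')
    (hs.inter (c.open_source.inter c'.open_source).measurableSet) (fun p hp => hp.2.1)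
    (fun p hp => hp.2.2) fun p hp => isHolomorphicChange_apply hc hc' hp.2.1 hp.2.2).symm

variable [LindelofSpace M]

theorem areaMeasure_restrict_source (hf : IsConformalImmersion f)
    (hc : c ∈ IsManifold.maximalAtlas 𝓘(ℂ, ℂ) ω M) :
    (areaMeasure f).restrict c.source = localArea f c := by
  have restrict_chart (p : M) : (areaMeasure f).restrict (chartAt ℂ p).source =
      localArea f (chartAt ℂ p) := by
    rw [areaMeasure, iSup_subtype']
    refine restrict_iSup_eq_of_restrict_le
      (ν := fun e : atlas ℂ M => localArea f (e : OpenPartialHomeomorph M ℂ))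
      (i := ⟨chartAt ℂ p, chart_mem_atlas ℂ p⟩)
      (chartAt ℂ p).open_source.measurableSet (localArea_restrict_source f _) fun e => ?_
    rw [hf.localArea_restrict_comm (IsManifold.chart_mem_maximalAtlas p)
      (IsManifold.subset_maximalAtlas e.2)]
    exact Measure.restrict_le_self
  obtain ⟨t, ht, cover⟩ := LindelofSpace.elim_nhds_subcover
    (fun p : M => (chartAt ℂ p).source) fun p => chart_source_mem_nhds ℂ p
  refine Measure.ext_of_biUnion_eq_univ ht cover fun p _ => ?_
  rw [Measure.restrict_comm (chartAt ℂ p).open_source.measurableSet, restrict_chart,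
    hf.localArea_restrict_comm hc (IsManifold.chart_mem_maximalAtlas p)]

theorem areaMeasure_restrict (hf : IsConformalImmersion f)
    (hc : c ∈ IsManifold.maximalAtlas 𝓘(ℂ, ℂ) ω M) (hs : MeasurableSet s)
    (hsc : s ⊆ c.source) :
    (areaMeasure f).restrict s = ((volume.restrict (c '' s)).withDensity
      fun z => ENNReal.ofReal (firstForm f c 1 1 z)).map c.symm := by
  rw [← (hf.isConformalParam hc).localArea_restrict hs hsc, ← hf.areaMeasure_restrict_source hc,
    Measure.restrict_restrict hs, Set.inter_eq_left.2 hsc]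

theorem areaMeasure_apply (hf : IsConformalImmersion f)
    (hc : c ∈ IsManifold.maximalAtlas 𝓘(ℂ, ℂ) ω M) (hs : MeasurableSet s)
    (hsc : s ⊆ c.source) :
    areaMeasure f s = ∫⁻ z in c '' s, ENNReal.ofReal (firstForm f c 1 1 z) := by
  rw [← (hf.isConformalParam hc).localArea_apply hs hsc, ← hf.areaMeasure_restrict_source hc,
    Measure.restrict_eq_self _ hsc]

theorem isLocallyFiniteMeasure_areaMeasure (hf : IsConformalImmersion f) :
    IsLocallyFiniteMeasure (areaMeasure f) := by
  refine ⟨fun p => ?_⟩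
  have hc := IsManifold.chart_mem_maximalAtlas (I := 𝓘(ℂ, ℂ)) (n := ω) p
  set c := chartAt ℂ p
  obtain ⟨K, hK, mem_interior, hKc⟩ := exists_compact_subset c.open_target (mem_chart_target ℂ p)
  have isOpen_preimage : IsOpen (c.source ∩ c ⁻¹' interior K) :=
    c.isOpen_inter_preimage isOpen_interior
  refine ⟨_, isOpen_preimage.mem_nhds ⟨mem_chart_source ℂ p, mem_interior⟩, ?_⟩
  rw [hf.areaMeasure_apply hc isOpen_preimage.measurableSet Set.inter_subset_left]
  have integrableOn_firstForm : IntegrableOn (firstForm f c 1 1) K :=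
    ((hf.isSmoothParam hc).continuousOn_firstForm 1 1 |>.mono hKc).integrableOn_compact hK
  exact (integrableOn_firstForm.mono_set
    (Set.image_subset_iff.2 fun q hq => (interior_subset hq.2 : c q ∈ K))).lintegral_lt_top

theorem aestronglyMeasurable_map_symm {F : Type*} [TopologicalSpace F] {g : M → F}
    (hf : IsConformalImmersion f) (hc : c ∈ IsManifold.maximalAtlas 𝓘(ℂ, ℂ) ω M)
    (hs : MeasurableSet s) (hsc : s ⊆ c.source) (hg : AEStronglyMeasurable g (areaMeasure f)) :
    AEStronglyMeasurable g (((volume.restrict (c '' s)).withDensity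
      fun z => ENNReal.ofReal (firstForm f c 1 1 z)).map c.symm) :=
  hf.areaMeasure_restrict hc hs hsc ▸ hg.restrict

section Integral

variable {F : Type*} [NormedAddCommGroup F] [NormedSpace ℝ F] {g : M → F}

theorem integrableOn_areaMeasure_iff (hf : IsConformalImmersion f)
    (hc : c ∈ IsManifold.maximalAtlas 𝓘(ℂ, ℂ) ω M) (hs : MeasurableSet s)
    (hsc : s ⊆ c.source) (hg : AEStronglyMeasurable g (areaMeasure f)) :
    IntegrableOn g s (areaMeasure f) ↔
      IntegrableOn (fun z => firstForm f c 1 1 z • g (c.symm z)) (c '' s) := by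
  rw [IntegrableOn, hf.areaMeasure_restrict hc hs hsc,
    integrable_map_measure (hf.aestronglyMeasurable_map_symm hc hs hsc hg)
      (aemeasurable_symm_withDensity hs hsc _),
    integrable_withDensity_iff_integrable_smul₀'
      ((hf.isSmoothParam hc).aemeasurable_firstForm hs hsc)
      (.of_forall fun _ => ENNReal.ofReal_lt_top)]
  refine integrableOn_congr_fun (fun z hz => ?_) (measurableSet_image_of_subset_source hs hsc)
  simp only [Function.comp_apply, ENNReal.toReal_ofReal
    ((hf.isConformalParam hc).firstForm_pos z ((c.mapsTo.mono_left hsc).image_subset hz)).le]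

theorem setIntegral_areaMeasure (hf : IsConformalImmersion f)
    (hc : c ∈ IsManifold.maximalAtlas 𝓘(ℂ, ℂ) ω M) (hs : MeasurableSet s)
    (hsc : s ⊆ c.source) (hg : AEStronglyMeasurable g (areaMeasure f)) :
    ∫ p in s, g p ∂areaMeasure f = ∫ z in c '' s, firstForm f c 1 1 z • g (c.symm z) := by
  rw [hf.areaMeasure_restrict hc hs hsc,
    integral_map (aemeasurable_symm_withDensity hs hsc _)
      (hf.aestronglyMeasurable_map_symm hc hs hsc hg),
    integral_withDensity_eq_integral_toReal_smul₀
      ((hf.isSmoothParam hc).aemeasurable_firstForm hs hsc)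
      (.of_forall fun _ => ENNReal.ofReal_lt_top)]
  refine setIntegral_congr_fun (measurableSet_image_of_subset_source hs hsc) fun z hz => ?_
  simp only [ENNReal.toReal_ofReal ((hf.isConformalParam hc).firstForm_pos z
    ((c.mapsTo.mono_left hsc).image_subset hz)).le]

end Integral

end IsConformalImmersion

end Area

/-! ### The divergence theorem -/

section Divergence

variable {M : Type*} [TopologicalSpace M] {f : M → Nil} {c c' : OpenPartialHomeomorph M ℂ}
  {ρ : M → ℝ} {z : ℂ}

/-- The derivative of `ρ` along the tangential part of `e₃`, in a conformal parameter. -/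
def verticalDerivIn (f : M → Nil) (ρ : M → ℝ) (c : OpenPartialHomeomorph M ℂ) (z : ℂ) : ℝ :=
  (fderiv ℝ (ρ ∘ c.symm) z 1 * leftDeriv f c 1 z 2 +
    fderiv ℝ (ρ ∘ c.symm) z I * leftDeriv f c I z 2) / firstForm f c 1 1 z

theorem IsHolomorphicChange.verticalDerivIn_eq {φ : ℂ → ℂ} (h : IsHolomorphicChange c c' φ z)
    (hc : IsConformalParam f c') (hρ : DifferentiableAt ℝ (ρ ∘ c'.symm) (φ z)) :
    verticalDerivIn f ρ c z = verticalDerivIn f ρ c' (φ z) := by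
  have fderiv_eq (v : ℂ) : fderiv ℝ (ρ ∘ c.symm) z v =
      (deriv φ z * v).re * fderiv ℝ (ρ ∘ c'.symm) (φ z) 1 +
        (deriv φ z * v).im * fderiv ℝ (ρ ∘ c'.symm) (φ z) I := by
    rw [(h.symm_eventuallyEq.fun_comp ρ).fderiv_eq, ← Function.comp_assoc,
      fderiv_comp_restrictScalars hρ h.analyticAt.differentiableAt,
      map_eq_re_smul_add_im_smul, smul_eq_mul, smul_eq_mul]
  have firstForm_pos := hc.firstForm_pos _ h.map_mem_target
  have normSq_pos := Complex.normSq_pos.2 h.deriv_ne_zero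
  rw [verticalDerivIn, verticalDerivIn, fderiv_eq, fderiv_eq, h.leftDeriv_one_eq hc.smooth,
    h.leftDeriv_I_eq hc.smooth, h.firstForm_one_one_eq hc,
    div_eq_div_iff (by positivity) (by positivity), Complex.normSq_apply]
  simp only [mul_one, Complex.mul_re, Complex.mul_im, Complex.I_re, Complex.I_im, Pi.add_apply,
    Pi.smul_apply, smul_eq_mul]
  ring

theorem IsConformalParam.divLeftDeriv_two (hc : IsConformalParam f c) (hz : z ∈ c.target) :
    divLeftDeriv f c z 2 = 2 * meanCurvatureIn f c z * normalThird f c z * firstForm f c 1 1 z := by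
  have tension_two := tension_apply f c z 2
  rw [hc.tension_eq hz, Pi.smul_apply, smul_eq_mul, Pi.add_apply, nabla_apply, nabla_apply]
    at tension_two
  rw [normalThird, mul_assoc, div_mul_cancel₀ _ (hc.firstForm_pos z hz).ne', tension_two]
  simp [mul_comm]

theorem IsConformalParam.div_mul_leftDeriv_two (hc : IsConformalParam f c) (hz : z ∈ c.target)
    (hρ : DifferentiableAt ℝ (ρ ∘ c.symm) z) :
    fderiv ℝ (fun w => ρ (c.symm w) * leftDeriv f c 1 w 2) z 1 +
        fderiv ℝ (fun w => ρ (c.symm w) * leftDeriv f c I w 2) z I =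
      firstForm f c 1 1 z * (ρ (c.symm z) * (2 * meanCurvatureIn f c z * normalThird f c z) +
        verticalDerivIn f ρ c z) := by
  have product_rule (v : ℂ) : fderiv ℝ (fun w => ρ (c.symm w) * leftDeriv f c v w 2) z v =
      ρ (c.symm z) * fderiv ℝ (leftDeriv f c v · 2) z v +
        leftDeriv f c v z 2 * fderiv ℝ (ρ ∘ c.symm) z v :=
    congrArg (· v) (fderiv_fun_mul hρ (hc.smooth.differentiableAt_leftDeriv hz v 2))
  have divLeftDeriv_two := hc.divLeftDeriv_two hz
  rw [divLeftDeriv] at divLeftDeriv_two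
  rw [product_rule, product_rule, verticalDerivIn, mul_add,
    mul_div_cancel₀ _ (hc.firstForm_pos z hz).ne']
  linear_combination ρ (c.symm z) * divLeftDeriv_two

variable [ChartedSpace ℂ M] {p : M}

/-- The derivative of `ρ` along the tangential part of `e₃`. -/
def verticalDeriv (f : M → Nil) (ρ : M → ℝ) (p : M) : ℝ :=
  verticalDerivIn f ρ (chartAt ℂ p) (chartAt ℂ p p)

/-- The divergence of `ρ e₃ᵀ`, where `e₃ᵀ` is the tangential part of `e₃`: since `e₃` is a Killing
field, the divergence of `e₃ᵀ` is `2 H N₃`. -/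
def verticalDivergence (f : M → Nil) (ρ : M → ℝ) (p : M) : ℝ :=
  ρ p * (2 * meanCurvature f p * normalThirdAt f p) + verticalDeriv f ρ p

theorem verticalDeriv_eq_zero (hp : ρ =ᶠ[𝓝 p] 0) : verticalDeriv f ρ p = 0 := by
  have tendsto_symm : Tendsto (chartAt ℂ p).symm (𝓝 (chartAt ℂ p p)) (𝓝 p) :=
    (chartAt ℂ p).tendsto_symm (mem_chart_source ℂ p)
  have comp_eq_zero : ρ ∘ (chartAt ℂ p).symm =ᶠ[𝓝 (chartAt ℂ p p)] 0 := tendsto_symm.eventually hp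
  rw [verticalDeriv, verticalDerivIn, comp_eq_zero.fderiv_eq]
  simp

theorem verticalDivergence_eq_zero (hp : p ∉ tsupport ρ) : verticalDivergence f ρ p = 0 := by
  rw [verticalDivergence, image_eq_zero_of_notMem_tsupport hp,
    verticalDeriv_eq_zero (notMem_tsupport_iff_eventuallyEq.1 hp), zero_mul, zero_add]

variable [IsManifold 𝓘(ℂ, ℂ) ω M]

theorem differentiableAt_comp_symm (hρ : ContMDiff 𝓘(ℝ, ℂ) 𝓘(ℝ, ℝ) ∞ ρ)
    (hc : c ∈ IsManifold.maximalAtlas 𝓘(ℂ, ℂ) ω M) (hz : z ∈ c.target) :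
    DifferentiableAt ℝ (ρ ∘ c.symm) z :=
  ((contDiffOn_comp_symm hρ hc).differentiableOn (by simp)).differentiableAt
    (c.open_target.mem_nhds hz)

theorem sum_verticalDivergence {ι : Type*} [Fintype ι] {ρ : ι → M → ℝ}
    (hρ : ∀ i, ContMDiff 𝓘(ℝ, ℂ) 𝓘(ℝ, ℝ) ∞ (ρ i)) (sum_eq_one : ∀ p, ∑ i, ρ i p = 1) (p : M) :
    ∑ i, verticalDivergence f (ρ i) p = 2 * meanCurvature f p * normalThirdAt f p := by
  have sum_fderiv (v : ℂ) :
      ∑ i, fderiv ℝ (ρ i ∘ (chartAt ℂ p).symm) (chartAt ℂ p p) v = 0 := by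
    rw [← sum_apply, ← fderiv_sum fun i _ => differentiableAt_comp_symm (hρ i)
      (IsManifold.chart_mem_maximalAtlas p) (mem_chart_target ℂ p)]
    have sum_comp : ∑ i, ρ i ∘ (chartAt ℂ p).symm = fun _ => 1 := by
      ext w
      simp [sum_eq_one]
    simp [sum_comp]
  simp only [verticalDivergence, verticalDeriv, verticalDerivIn, Finset.sum_add_distrib,
    ← Finset.sum_mul, ← Finset.sum_div, sum_eq_one, sum_fderiv, one_mul, zero_mul, add_zero,
    zero_div]

namespace IsConformalImmersion

theorem verticalDeriv_eq (hf : IsConformalImmersion f) (hρ : ContMDiff 𝓘(ℝ, ℂ) 𝓘(ℝ, ℝ) ∞ ρ)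
    (hc : c ∈ IsManifold.maximalAtlas 𝓘(ℂ, ℂ) ω M) (hp : p ∈ c.source) :
    verticalDeriv f ρ p = verticalDerivIn f ρ c (c p) := by
  have change := isHolomorphicChange_apply (IsManifold.chart_mem_maximalAtlas p) hc
    (mem_chart_source ℂ p) hp
  rw [verticalDeriv, change.verticalDerivIn_eq (hf.isConformalParam hc)
      (differentiableAt_comp_symm hρ hc change.map_mem_target), Function.comp_apply,
    (chartAt ℂ p).left_inv (mem_chart_source ℂ p)]

theorem continuous_verticalDeriv (hf : IsConformalImmersion f)
    (hρ : ContMDiff 𝓘(ℝ, ℂ) 𝓘(ℝ, ℝ) ∞ ρ) : Continuous (verticalDeriv f ρ) := by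
  refine continuous_of_forall_chartAt (G := fun p => verticalDerivIn f ρ (chartAt ℂ p))
    (fun p => ?_)
    fun p _ hq => hf.verticalDeriv_eq hρ (IsManifold.chart_mem_maximalAtlas p) hq
  have hc := hf.isConformalParam_chartAt p
  have continuousOn_fderiv (v : ℂ) : ContinuousOn
      (fun z => fderiv ℝ (ρ ∘ (chartAt ℂ p).symm) z v) (chartAt ℂ p).target :=
    (contDiffOn_fderiv_apply (m := ∞) (chartAt ℂ p).open_target
      (contDiffOn_comp_symm hρ (IsManifold.chart_mem_maximalAtlas p)) (by simp) v).continuousOn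
  exact (((continuousOn_fderiv 1).mul (hc.smooth.contDiffOn_leftDeriv 1 2).continuousOn).add
    ((continuousOn_fderiv I).mul (hc.smooth.contDiffOn_leftDeriv I 2).continuousOn)).div
      (hc.smooth.continuousOn_firstForm 1 1) fun z hz => (hc.firstForm_pos z hz).ne'

theorem continuous_verticalDivergence (hf : IsConformalImmersion f)
    (hρ : ContMDiff 𝓘(ℝ, ℂ) 𝓘(ℝ, ℝ) ∞ ρ) : Continuous (verticalDivergence f ρ) :=
  (hρ.continuous.mul ((continuous_const.mul hf.continuous_meanCurvature).mul
    hf.continuous_normalThirdAt)).add (hf.continuous_verticalDeriv hρ)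

theorem firstForm_mul_verticalDivergence (hf : IsConformalImmersion f)
    (hρ : ContMDiff 𝓘(ℝ, ℂ) 𝓘(ℝ, ℝ) ∞ ρ) (hc : c ∈ IsManifold.maximalAtlas 𝓘(ℂ, ℂ) ω M)
    (hz : z ∈ c.target) :
    firstForm f c 1 1 z * verticalDivergence f ρ (c.symm z) =
      fderiv ℝ (fun w => ρ (c.symm w) * leftDeriv f c 1 w 2) z 1 +
        fderiv ℝ (fun w => ρ (c.symm w) * leftDeriv f c I w 2) z I := by
  rw [(hf.isConformalParam hc).div_mul_leftDeriv_two hz (differentiableAt_comp_symm hρ hc hz),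
    verticalDivergence, hf.meanCurvature_eq hc (c.map_target hz),
    hf.normalThirdAt_eq hc (c.map_target hz), hf.verticalDeriv_eq hρ hc (c.map_target hz),
    c.right_inv hz]

variable [CompactSpace M] [MeasurableSpace M] [BorelSpace M]

theorem integrable_of_continuous (hf : IsConformalImmersion f) {F : Type*} [NormedAddCommGroup F]
    [SecondCountableTopology F] {g : M → F} (hg : Continuous g) :
    Integrable g (areaMeasure f) :=
  have := hf.isLocallyFiniteMeasure_areaMeasure
  hg.integrable_of_hasCompactSupport (.of_compactSpace g)

theorem integral_verticalDivergence_of_tsupport_subset (hf : IsConformalImmersion f)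
    (hρ : ContMDiff 𝓘(ℝ, ℂ) 𝓘(ℝ, ℝ) ∞ ρ) (hc : c ∈ IsManifold.maximalAtlas 𝓘(ℂ, ℂ) ω M)
    (tsupport_subset : tsupport ρ ⊆ c.source) :
    ∫ p, verticalDivergence f ρ p ∂areaMeasure f = 0 := by
  have isCompact_image : IsCompact (c '' tsupport ρ) :=
    (isClosed_tsupport ρ).isCompact.image_of_continuousOn (c.continuousOn.mono tsupport_subset)
  have image_subset : c '' tsupport ρ ⊆ c.target :=
    (c.mapsTo.mono_left tsupport_subset).image_subset
  have contDiffOn (v : ℂ) : ContDiffOn ℝ 1 (fun w => ρ (c.symm w) * leftDeriv f c v w 2) c.target :=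
    ((contDiffOn_comp_symm hρ hc).mul ((hf.isSmoothParam hc).contDiffOn_leftDeriv v 2)).of_le
      (by simp)
  have eq_zero (v : ℂ) (z : ℂ) (hz : z ∈ c.target) (hz' : z ∉ c '' tsupport ρ) :
      ρ (c.symm z) * leftDeriv f c v z 2 = 0 := by
    rw [image_eq_zero_of_notMem_tsupport fun h => hz' ⟨_, h, c.right_inv hz⟩, zero_mul]
  have integrable (v : ℂ) := integrableOn_fderiv_apply (μ := volume) c.open_target
    isCompact_image image_subset (contDiffOn v) (eq_zero v) v
  have integral (v : ℂ) := setIntegral_fderiv_apply_eq_zero (μ := volume) c.open_target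
    isCompact_image image_subset (contDiffOn v) (eq_zero v) v
  rw [← setIntegral_eq_integral_of_forall_compl_eq_zero (s := c.source) fun p hp =>
      verticalDivergence_eq_zero fun h => hp (tsupport_subset h),
    hf.setIntegral_areaMeasure hc c.open_source.measurableSet subset_rfl
      (hf.integrable_of_continuous (hf.continuous_verticalDivergence hρ)).aestronglyMeasurable,
    c.image_source_eq_target]
  refine (setIntegral_congr_fun c.open_target.measurableSet fun z hz =>
    hf.firstForm_mul_verticalDivergence hρ hc hz).trans ?_
  rw [integral_add (integrable 1) (integrable I), integral, integral, add_zero]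

theorem integral_meanCurvature_mul_normalThirdAt [T2Space M] (hf : IsConformalImmersion f) :
    ∫ p, meanCurvature f p * normalThirdAt f p ∂areaMeasure f = 0 := by
  have := isManifold_restrictScalars M
  obtain ⟨t, -, cover⟩ := isCompact_univ.elim_nhds_subcover
    (fun p : M => (chartAt ℂ p).source) fun p _ => chart_source_mem_nhds ℂ p
  obtain ⟨ρ, subordinate⟩ := SmoothPartitionOfUnity.exists_isSubordinate 𝓘(ℝ, ℂ)
    (isClosed_univ (X := M)) (fun p : t => (chartAt ℂ (p : M)).source)
    (fun p => (chartAt ℂ (p : M)).open_source) (cover.trans (Set.biUnion_eq_iUnion _ _).subset)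
  have contMDiff (i : t) : ContMDiff 𝓘(ℝ, ℂ) 𝓘(ℝ, ℝ) ∞ (ρ i) := (ρ i).contMDiff
  have sum_eq_one (p : M) : ∑ i, ρ i p = 1 :=
    (finsum_eq_sum_of_fintype _).symm.trans (ρ.sum_eq_one (Set.mem_univ p))
  have two_mul_integral : 2 * ∫ p, meanCurvature f p * normalThirdAt f p ∂areaMeasure f = 0 :=
    calc
      _ = ∫ p, ∑ i, verticalDivergence f (ρ i) p ∂areaMeasure f := by
        simp only [sum_verticalDivergence contMDiff sum_eq_one, mul_assoc, integral_const_mul]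
      _ = ∑ i, ∫ p, verticalDivergence f (ρ i) p ∂areaMeasure f :=
        integral_finsetSum _ fun i _ =>
          hf.integrable_of_continuous (hf.continuous_verticalDivergence (contMDiff i))
      _ = 0 := Finset.sum_eq_zero fun i _ => hf.integral_verticalDivergence_of_tsupport_subset
        (contMDiff i) (IsManifold.chart_mem_maximalAtlas (i : M)) (subordinate i)
  simpa using two_mul_integral

end IsConformalImmersion

end Divergence

section Spinor

variable {M : Type*} [TopologicalSpace M] {f : M → Nil} {c : OpenPartialHomeomorph M ℂ} {z : ℂ}

/-! ### The structure equations in terms of `Z` -/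

/-- The components `Z̄₁, Z̄₂, Z̄₃` of `f⁻¹ ∂̄f`. -/
def Zbar (f : M → Nil) (c : OpenPartialHomeomorph M ℂ) (k : Fin 3) (z : ℂ) : ℂ :=
  star (Zcomp f c k z)

theorem leftDeriv_one_eq_Zcomp (f : M → Nil) (c : OpenPartialHomeomorph M ℂ) (z : ℂ)
    (k : Fin 3) : (leftDeriv f c 1 z k : ℂ) = Zcomp f c k z + Zbar f c k z := by
  simp only [Zbar, Zcomp, star_div₀, star_sub, star_mul', Complex.star_def, Complex.conj_ofReal,
    Complex.conj_I, map_ofNat]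
  ring

theorem leftDeriv_I_eq_Zcomp (f : M → Nil) (c : OpenPartialHomeomorph M ℂ) (z : ℂ)
    (k : Fin 3) : (leftDeriv f c I z k : ℂ) = I * (Zcomp f c k z - Zbar f c k z) := by
  simp only [Zbar, Zcomp, star_div₀, star_sub, star_mul', Complex.star_def, Complex.conj_ofReal,
    Complex.conj_I, map_ofNat]
  linear_combination (leftDeriv f c I z k : ℂ) * Complex.I_sq

namespace IsConformalParam

theorem sum_sq_Zcomp (hc : IsConformalParam f c) (hz : z ∈ c.target) :
    Zcomp f c 0 z ^ 2 + Zcomp f c 1 z ^ 2 + Zcomp f c 2 z ^ 2 = 0 := by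
  have hG := congrArg ((↑) : ℝ → ℂ) (hc.firstForm_I_I z hz)
  have hF := congrArg ((↑) : ℝ → ℂ) (hc.firstForm_one_I z hz)
  simp only [firstForm_eq, Matrix.vec3_dotProduct] at hG hF
  push_cast at hG hF
  simp only [Zcomp]
  linear_combination -hG / 4 - I / 2 * hF + ((leftDeriv f c I z 0 : ℂ) ^ 2 +
    (leftDeriv f c I z 1 : ℂ) ^ 2 + (leftDeriv f c I z 2 : ℂ) ^ 2) / 4 * Complex.I_sq

theorem Zcomp_zero_ne_zero_or_Zcomp_one_ne_zero (hc : IsConformalParam f c) (hz : z ∈ c.target) :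
    Zcomp f c 0 z ≠ 0 ∨ Zcomp f c 1 z ≠ 0 := by
  by_contra! h
  have third : Zcomp f c 2 z = 0 := by simpa [h] using hc.sum_sq_Zcomp hz
  have leftDeriv_eq_zero : leftDeriv f c 1 z = 0 := by
    ext k
    have := leftDeriv_one_eq_Zcomp f c z k
    fin_cases k <;> simpa [Zbar, h, third] using this
  exact (hc.firstForm_pos z hz).ne' (by rw [firstForm_eq, leftDeriv_eq_zero, dotProduct_zero])

theorem divLeftDeriv_eq (hc : IsConformalParam f c) (hz : z ∈ c.target) (k : Fin 3) :
    divLeftDeriv f c z k = 2 * meanCurvatureIn f c z * normal f c z k -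
      (nabla (leftDeriv f c 1 z) (leftDeriv f c 1 z) +
        nabla (leftDeriv f c I z) (leftDeriv f c I z)) k := by
  have := congrFun (hc.tension_eq hz) k
  rw [tension_apply, Pi.smul_apply, smul_eq_mul] at this
  exact eq_sub_of_add_eq this

/-- Since the tension is `2H` times the normal vector `-2i Z × Z̄`, the second derivatives of `f`
enter `∂̄Z` only through `H`. -/
theorem dzbar_Zcomp (hc : IsConformalParam f c) (hz : z ∈ c.target) :
    dzbar (Zcomp f c 0) z =
        -I * meanCurvatureIn f c z * (Zcomp f c 1 z * Zbar f c 2 z - Zcomp f c 2 z * Zbar f c 1 z) -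
          (Zcomp f c 1 z * Zbar f c 2 z + Zbar f c 1 z * Zcomp f c 2 z) / 2 ∧
      dzbar (Zcomp f c 1) z =
        -I * meanCurvatureIn f c z * (Zcomp f c 2 z * Zbar f c 0 z - Zcomp f c 0 z * Zbar f c 2 z) +
          (Zcomp f c 0 z * Zbar f c 2 z + Zbar f c 0 z * Zcomp f c 2 z) / 2 ∧
      dzbar (Zcomp f c 2) z = (1 / 2 - I * meanCurvatureIn f c z) *
        (Zcomp f c 0 z * Zbar f c 1 z - Zcomp f c 1 z * Zbar f c 0 z) := by
  have four_mul (k : Fin 3) := hc.smooth.four_mul_dzbar_Zcomp hz k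
  simp only [hc.divLeftDeriv_eq hz] at four_mul
  have zero := four_mul 0
  have one := four_mul 1
  have two := four_mul 2
  simp only [normal, cross_apply, nabla_apply, bracket_apply, Pi.add_apply, Matrix.cons_val]
    at zero one two
  push_cast at zero one two
  simp only [leftDeriv_one_eq_Zcomp, leftDeriv_I_eq_Zcomp] at zero one two
  refine ⟨?_, ?_, ?_⟩
  · linear_combination zero / 4 - (Zcomp f c 1 z - Zbar f c 1 z) *
      (Zcomp f c 2 z - Zbar f c 2 z) / 4 * Complex.I_sq
  · linear_combination one / 4 + (Zcomp f c 0 z - Zbar f c 0 z) *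
      (Zcomp f c 2 z - Zbar f c 2 z) / 4 * Complex.I_sq
  · linear_combination two / 4 - (Zcomp f c 0 z * Zbar f c 1 z - Zcomp f c 1 z * Zbar f c 0 z) /
      2 * Complex.I_sq

end IsConformalParam

end Spinor

/-! ### Generating spinors and their potentials -/

section Potential

variable {M : Type*} [TopologicalSpace M] {f : M → Nil} {c : OpenPartialHomeomorph M ℂ}
  {D : Set ℂ} {ψ₁ ψ₂ U V : ℂ → ℂ} {z : ℂ}

/-- The common value `(H/2)(|ψ₁|² + |ψ₂|²) + (i/4)(|ψ₂|² - |ψ₁|²)` of the potentials of a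
generating spinor. -/
def diracPotential (f : M → Nil) (c : OpenPartialHomeomorph M ℂ) (ψ₁ ψ₂ : ℂ → ℂ) (z : ℂ) : ℂ :=
  (meanCurvatureIn f c z / 2 * (Complex.normSq (ψ₁ z) + Complex.normSq (ψ₂ z)) : ℝ) +
    ((Complex.normSq (ψ₂ z) - Complex.normSq (ψ₁ z)) / 4 : ℝ) * I

theorem diracPotential_eq (f : M → Nil) (c : OpenPartialHomeomorph M ℂ) (ψ₁ ψ₂ : ℂ → ℂ) (z : ℂ) :
    diracPotential f c ψ₁ ψ₂ z =
      meanCurvatureIn f c z / 2 * (ψ₁ z * star (ψ₁ z) + ψ₂ z * star (ψ₂ z)) +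
        I / 4 * (ψ₂ z * star (ψ₂ z) - ψ₁ z * star (ψ₁ z)) := by
  simp only [diracPotential, Complex.star_def, Complex.mul_conj]
  push_cast
  ring

theorem star_diracPotential (f : M → Nil) (c : OpenPartialHomeomorph M ℂ) (ψ₁ ψ₂ : ℂ → ℂ) (z : ℂ) :
    star (diracPotential f c ψ₁ ψ₂ z) =
      meanCurvatureIn f c z / 2 * (ψ₁ z * star (ψ₁ z) + ψ₂ z * star (ψ₂ z)) -
        I / 4 * (ψ₂ z * star (ψ₂ z) - ψ₁ z * star (ψ₁ z)) := by
  simp only [diracPotential, Complex.star_def, map_add, map_mul, Complex.conj_ofReal,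
    Complex.conj_I, Complex.mul_conj]
  push_cast
  ring

theorem diracPotential_im (f : M → Nil) (c : OpenPartialHomeomorph M ℂ) (ψ₁ ψ₂ : ℂ → ℂ) (z : ℂ) :
    (diracPotential f c ψ₁ ψ₂ z).im =
      (Complex.normSq (ψ₂ z) - Complex.normSq (ψ₁ z)) / 4 := by
  rw [diracPotential, Complex.add_im, Complex.ofReal_im, Complex.im_ofReal_mul, Complex.I_im,
    zero_add, mul_one]

/-- `ψ₁²` and `ψ̄₂²` are `-i Z₁ - Z₂` and `-i Z₁ + Z₂`, whose product is `Z₃²` by conformality. -/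
theorem IsConformalParam.exists_isGeneratingSpinor (hc : IsConformalParam f c)
    (hz : z ∈ c.target) :
    ∃ D ⊆ c.target, IsOpen D ∧ z ∈ D ∧ ∃ ψ₁ ψ₂, IsGeneratingSpinor f c D ψ₁ ψ₂ := by
  have contDiffOn := hc.smooth.contDiffOn_Zcomp
  have ne_zero :
      -I * Zcomp f c 0 z - Zcomp f c 1 z ≠ 0 ∨ -I * Zcomp f c 0 z + Zcomp f c 1 z ≠ 0 := by
    by_contra! h
    rcases hc.Zcomp_zero_ne_zero_or_Zcomp_one_ne_zero hz with h₀ | h₁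
    · refine h₀ ?_
      linear_combination I / 2 * (h.1 + h.2) + Zcomp f c 0 z * Complex.I_sq
    · refine h₁ ?_
      linear_combination (h.2 - h.1) / 2
  obtain ⟨D, hD, hDo, hzD, a, b, ha, hb, hab⟩ := exists_contDiffOn_sq_sq_mul c.open_target
    ((contDiffOn_const.mul (contDiffOn 0)).sub (contDiffOn 1))
    ((contDiffOn_const.mul (contDiffOn 0)).add (contDiffOn 1)) (contDiffOn 2)
    (fun ζ hζ => by
      linear_combination Zcomp f c 0 ζ ^ 2 * Complex.I_sq - hc.sum_sq_Zcomp hζ) hz ne_zero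
  refine ⟨D, hD, hDo, hzD, a, fun ζ => star (b ζ), ha, Complex.conjCLE.contDiff.comp_contDiffOn hb,
    fun ζ hζ => ?_, fun ζ hζ => ?_, fun ζ hζ => ?_⟩
  · rw [star_star, (hab ζ hζ).1, (hab ζ hζ).2.1]
    linear_combination Zcomp f c 0 ζ * Complex.I_sq
  · rw [star_star, (hab ζ hζ).1, (hab ζ hζ).2.1]
    ring
  · rw [star_star, (hab ζ hζ).2.2]

namespace IsGeneratingSpinor

theorem Zbar_eq (h : IsGeneratingSpinor f c D ψ₁ ψ₂) (hz : z ∈ D) :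
    Zbar f c 0 z = -I / 2 * (ψ₂ z ^ 2 + star (ψ₁ z) ^ 2) ∧
      Zbar f c 1 z = 1 / 2 * (ψ₂ z ^ 2 - star (ψ₁ z) ^ 2) ∧
      Zbar f c 2 z = star (ψ₁ z) * ψ₂ z := by
  simp only [Zbar]
  rw [h.eq₁ z hz, h.eq₂ z hz, h.eq₃ z hz]
  simp

theorem firstForm_eq (h : IsGeneratingSpinor f c D ψ₁ ψ₂) (hz : z ∈ D) :
    firstForm f c 1 1 z = (Complex.normSq (ψ₁ z) + Complex.normSq (ψ₂ z)) ^ 2 := by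
  obtain ⟨bar₀, bar₁, bar₂⟩ := h.Zbar_eq hz
  apply Complex.ofReal_injective
  rw [Nil.firstForm_eq, Matrix.vec3_dotProduct]
  push_cast
  simp only [leftDeriv_one_eq_Zcomp, h.eq₁ z hz, h.eq₂ z hz, h.eq₃ z hz, bar₀, bar₁, bar₂,
    ← Complex.mul_conj, Complex.star_def]
  linear_combination ((starRingEnd ℂ) (ψ₂ z) ^ 2 + ψ₁ z ^ 2 - ψ₂ z ^ 2 -
    (starRingEnd ℂ) (ψ₁ z) ^ 2) ^ 2 / 4 * Complex.I_sq

theorem normal_two_eq (h : IsGeneratingSpinor f c D ψ₁ ψ₂) (hz : z ∈ D) :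
    normal f c z 2 = (Complex.normSq (ψ₁ z) + Complex.normSq (ψ₂ z)) *
      (Complex.normSq (ψ₂ z) - Complex.normSq (ψ₁ z)) := by
  obtain ⟨bar₀, bar₁, -⟩ := h.Zbar_eq hz
  apply Complex.ofReal_injective
  simp only [normal, cross_apply, Matrix.cons_val]
  push_cast
  simp only [leftDeriv_one_eq_Zcomp, leftDeriv_I_eq_Zcomp, h.eq₁ z hz, h.eq₂ z hz, bar₀, bar₁,
    ← Complex.mul_conj, Complex.star_def]
  linear_combination -(ψ₂ z ^ 2 * (starRingEnd ℂ) (ψ₂ z) ^ 2 -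
    ψ₁ z ^ 2 * (starRingEnd ℂ) (ψ₁ z) ^ 2) * Complex.I_sq

theorem normSq_add_normSq_pos (h : IsGeneratingSpinor f c D ψ₁ ψ₂) (hc : IsConformalParam f c)
    (hD : D ⊆ c.target) (hz : z ∈ D) : 0 < Complex.normSq (ψ₁ z) + Complex.normSq (ψ₂ z) :=
  (add_nonneg (Complex.normSq_nonneg _) (Complex.normSq_nonneg _)).lt_of_ne' fun h0 =>
    (hc.firstForm_pos z (hD hz)).ne' (by rw [h.firstForm_eq hz, h0, sq, zero_mul])

theorem normalThird_eq (h : IsGeneratingSpinor f c D ψ₁ ψ₂) (hc : IsConformalParam f c)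
    (hD : D ⊆ c.target) (hz : z ∈ D) : normalThird f c z =
      (Complex.normSq (ψ₂ z) - Complex.normSq (ψ₁ z)) /
        (Complex.normSq (ψ₁ z) + Complex.normSq (ψ₂ z)) := by
  have pos := h.normSq_add_normSq_pos hc hD hz
  rw [normalThird, h.normal_two_eq hz, h.firstForm_eq hz]
  field_simp

theorem diracPotential_sq (h : IsGeneratingSpinor f c D ψ₁ ψ₂) (hc : IsConformalParam f c)
    (hD : D ⊆ c.target) (hz : z ∈ D) :
    diracPotential f c ψ₁ ψ₂ z ^ 2 = firstForm f c 1 1 z *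
      ((meanCurvatureIn f c z : ℂ) ^ 2 / 4 - (normalThird f c z : ℂ) ^ 2 / 16 +
        I / 4 * (meanCurvatureIn f c z * normalThird f c z)) := by
  have pos := h.normSq_add_normSq_pos hc hD hz
  rw [diracPotential, h.firstForm_eq hz, h.normalThird_eq hc hD hz]
  generalize Complex.normSq (ψ₁ z) + Complex.normSq (ψ₂ z) = r at *
  generalize Complex.normSq (ψ₂ z) - Complex.normSq (ψ₁ z) = s
  have hr : (r : ℂ) ≠ 0 := Complex.ofReal_ne_zero.2 pos.ne'
  push_cast
  field_simp
  linear_combination 64 * (s : ℂ) ^ 2 * Complex.I_sq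

theorem continuousOn_diracPotential (h : IsGeneratingSpinor f c D ψ₁ ψ₂)
    (hc : IsConformalParam f c) (hD : D ⊆ c.target) :
    ContinuousOn (diracPotential f c ψ₁ ψ₂) D := by
  have normSq₁ := Complex.continuous_normSq.comp_continuousOn h.smooth₁.continuousOn
  have normSq₂ := Complex.continuous_normSq.comp_continuousOn h.smooth₂.continuousOn
  exact (Complex.continuous_ofReal.comp_continuousOn
    (((hc.continuousOn_meanCurvatureIn.mono hD).div_const 2).mul (normSq₁.add normSq₂))).add
      ((Complex.continuous_ofReal.comp_continuousOn
        ((normSq₂.sub normSq₁).div_const 4)).mul continuousOn_const)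

theorem differentiableAt₁ (h : IsGeneratingSpinor f c D ψ₁ ψ₂) (hDo : IsOpen D) (hz : z ∈ D) :
    DifferentiableAt ℝ ψ₁ z :=
  (h.smooth₁.contDiffAt (hDo.mem_nhds hz)).differentiableAt (by simp)

theorem differentiableAt₂ (h : IsGeneratingSpinor f c D ψ₁ ψ₂) (hDo : IsOpen D) (hz : z ∈ D) :
    DifferentiableAt ℝ ψ₂ z :=
  (h.smooth₂.contDiffAt (hDo.mem_nhds hz)).differentiableAt (by simp)

theorem dzbar_Zcomp (h : IsGeneratingSpinor f c D ψ₁ ψ₂) (hDo : IsOpen D) (hz : z ∈ D) :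
    dzbar (Zcomp f c 0) z = I * (star (ψ₂ z) * star (dz ψ₂ z) + ψ₁ z * dzbar ψ₁ z) ∧
      dzbar (Zcomp f c 1) z = star (ψ₂ z) * star (dz ψ₂ z) - ψ₁ z * dzbar ψ₁ z ∧
      dzbar (Zcomp f c 2) z = ψ₁ z * star (dz ψ₂ z) + star (ψ₂ z) * dzbar ψ₁ z := by
  have d₁ := h.differentiableAt₁ hDo hz
  have d₂ := h.differentiableAt₂ hDo hz
  have d₂_star : DifferentiableAt ℝ (fun ζ => star (ψ₂ ζ)) z := d₂.star
  have congr {g : ℂ → ℂ} (k : Fin 3) (hg : ∀ ζ ∈ D, Zcomp f c k ζ = g ζ) :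
      dzbar (Zcomp f c k) z = dzbar g z :=
    dzbar_congr (eventually_of_mem (hDo.mem_nhds hz) hg)
  refine ⟨?_, ?_, ?_⟩
  · rw [congr 0 h.eq₁, dzbar_const_mul _ ((d₂_star.fun_pow 2).fun_add (d₁.fun_pow 2)),
      dzbar_add (d₂_star.fun_pow 2) (d₁.fun_pow 2), dzbar_sq d₂_star, dzbar_sq d₁, dzbar_star d₂]
    ring
  · rw [congr 1 h.eq₂, dzbar_const_mul _ ((d₂_star.fun_pow 2).fun_sub (d₁.fun_pow 2)),
      dzbar_sub (d₂_star.fun_pow 2) (d₁.fun_pow 2), dzbar_sq d₂_star, dzbar_sq d₁, dzbar_star d₂]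
    ring
  · rw [congr 2 h.eq₃, dzbar_mul d₁ d₂_star, dzbar_star d₂]

theorem dzbar_Zcomp_eq_diracPotential (h : IsGeneratingSpinor f c D ψ₁ ψ₂)
    (hc : IsConformalParam f c) (hD : D ⊆ c.target) (hz : z ∈ D) :
    dzbar (Zcomp f c 0) z = I * (ψ₁ z * ψ₂ z * diracPotential f c ψ₁ ψ₂ z -
        star (ψ₁ z * ψ₂ z * diracPotential f c ψ₁ ψ₂ z)) ∧
      dzbar (Zcomp f c 1) z = -(ψ₁ z * ψ₂ z * diracPotential f c ψ₁ ψ₂ z +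
        star (ψ₁ z * ψ₂ z * diracPotential f c ψ₁ ψ₂ z)) ∧
      dzbar (Zcomp f c 2) z = ψ₂ z * star (ψ₂ z) * diracPotential f c ψ₁ ψ₂ z -
        ψ₁ z * star (ψ₁ z) * star (diracPotential f c ψ₁ ψ₂ z) := by
  obtain ⟨zero, one, two⟩ := hc.dzbar_Zcomp (hD hz)
  obtain ⟨bar₀, bar₁, bar₂⟩ := h.Zbar_eq hz
  rw [zero, one, two, h.eq₁ z hz, h.eq₂ z hz, h.eq₃ z hz, bar₀, bar₁, bar₂]
  rw [star_mul', star_mul', star_diracPotential, diracPotential_eq]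
  generalize star (ψ₁ z) = P
  generalize star (ψ₂ z) = Q
  generalize ψ₁ z = p, ψ₂ z = q, meanCurvatureIn f c z = H
  refine ⟨?_, ?_, ?_⟩
  · linear_combination (p * q + P * Q) * (p * P - q * Q) / 4 * Complex.I_sq
  · linear_combination H / 2 * (p * q + P * Q) * (p * P + q * Q) * Complex.I_sq
  · linear_combination H / 2 * (p ^ 2 * P ^ 2 - q ^ 2 * Q ^ 2) * Complex.I_sq

theorem dirac (h : IsGeneratingSpinor f c D ψ₁ ψ₂) (hc : IsConformalParam f c) (hDo : IsOpen D)
    (hD : D ⊆ c.target) (hz : z ∈ D) :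
    dzbar ψ₁ z = diracPotential f c ψ₁ ψ₂ z * ψ₂ z ∧
      dz ψ₂ z = -(diracPotential f c ψ₁ ψ₂ z * ψ₁ z) := by
  obtain ⟨spinor₀, spinor₁, spinor₂⟩ := h.dzbar_Zcomp hDo hz
  obtain ⟨surface₀, surface₁, surface₂⟩ := h.dzbar_Zcomp_eq_diracPotential hc hD hz
  have sum_eq := mul_left_cancel₀ Complex.I_ne_zero (spinor₀.symm.trans surface₀)
  have sub_eq := spinor₁.symm.trans surface₁
  have ne_zero : ψ₁ z ≠ 0 ∨ star (ψ₂ z) ≠ 0 := by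
    by_contra! h0
    have pos := h.normSq_add_normSq_pos hc hD hz
    simp [h0.1, star_eq_zero.1 h0.2] at pos
  simp only [star_mul'] at sum_eq sub_eq
  obtain ⟨eq₁, eq₂⟩ := eq_and_eq_of_mul_eq_mul (x := dzbar ψ₁ z) (y := star (dz ψ₂ z))
    (x' := diracPotential f c ψ₁ ψ₂ z * ψ₂ z)
    (y' := -(star (diracPotential f c ψ₁ ψ₂ z) * star (ψ₁ z))) ne_zero
    (by linear_combination (sum_eq - sub_eq) / 2) (by linear_combination (sum_eq + sub_eq) / 2)
    (by linear_combination surface₂ - spinor₂)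
  exact ⟨eq₁, star_injective (by rw [eq₂, star_neg, star_mul'])⟩

theorem isDiracPotential (h : IsGeneratingSpinor f c D ψ₁ ψ₂) (hc : IsConformalParam f c)
    (hDo : IsOpen D) (hD : D ⊆ c.target) :
    IsDiracPotential D ψ₁ ψ₂ (diracPotential f c ψ₁ ψ₂) (diracPotential f c ψ₁ ψ₂) where
  continuous₁ := h.continuousOn_diracPotential hc hD
  continuous₂ := h.continuousOn_diracPotential hc hD
  eq₁ z hz := by rw [(h.dirac hc hDo hD hz).2, neg_add_cancel]
  eq₂ z hz := by rw [(h.dirac hc hDo hD hz).1, neg_add_cancel]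

/-- Where `ψ₁` vanishes identically the Dirac equation leaves `ψ₂ ≠ 0` with potential `0`, but the
imaginary part of the potential is then `|ψ₂|² / 4`. -/
theorem frequently_ne_zero (h : IsGeneratingSpinor f c D ψ₁ ψ₂) (hc : IsConformalParam f c)
    (hDo : IsOpen D) (hD : D ⊆ c.target) (hz : z ∈ D) :
    (∃ᶠ ζ in 𝓝 z, ψ₁ ζ ≠ 0) ∧ ∃ᶠ ζ in 𝓝 z, ψ₂ ζ ≠ 0 := by
  obtain ⟨dirac₁, dirac₂⟩ := h.dirac hc hDo hD hz
  have im_eq := diracPotential_im f c ψ₁ ψ₂ z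
  have pos := h.normSq_add_normSq_pos hc hD hz
  simp only [Filter.Frequently, not_not]
  constructor <;> intro eventually_eq_zero <;> have eq_zero := eventually_eq_zero.self_of_nhds <;>
    simp only [eq_zero, map_zero, zero_add, add_zero, sub_zero, zero_sub] at pos im_eq
  · rw [dzbar_congr (h := fun _ => 0) eventually_eq_zero] at dirac₁
    have potential_eq_zero : diracPotential f c ψ₁ ψ₂ z = 0 := by
      simpa [dzbar, Complex.normSq_pos.1 pos] using dirac₁
    rw [potential_eq_zero, Complex.zero_im] at im_eq
    linarith
  · rw [dz_congr (h := fun _ => 0) eventually_eq_zero] at dirac₂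
    have potential_eq_zero : diracPotential f c ψ₁ ψ₂ z = 0 := by
      simpa [dz, Complex.normSq_pos.1 pos] using dirac₂
    rw [potential_eq_zero, Complex.zero_im] at im_eq
    linarith

end IsGeneratingSpinor

namespace IsDiracPotential

theorem eq_diracPotential (hUV : IsDiracPotential D ψ₁ ψ₂ U V)
    (h : IsGeneratingSpinor f c D ψ₁ ψ₂) (hc : IsConformalParam f c) (hDo : IsOpen D)
    (hD : D ⊆ c.target) (hz : z ∈ D) :
    U z = diracPotential f c ψ₁ ψ₂ z ∧ V z = diracPotential f c ψ₁ ψ₂ z := by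
  have hDz := hDo.mem_nhds hz
  have continuousAt := (h.continuousOn_diracPotential hc hD).continuousAt hDz
  obtain ⟨frequently₁, frequently₂⟩ := h.frequently_ne_zero hc hDo hD hz
  constructor
  · refine tendsto_nhds_unique_of_frequently_eq (hUV.continuous₁.continuousAt hDz) continuousAt
      ((frequently₁.and_eventually hDz).mono fun ζ hζ => mul_right_cancel₀ hζ.1 ?_)
    linear_combination hUV.eq₁ ζ hζ.2 - (h.dirac hc hDo hD hζ.2).2
  · refine tendsto_nhds_unique_of_frequently_eq (hUV.continuous₂.continuousAt hDz) continuousAt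
      ((frequently₂.and_eventually hDz).mono fun ζ hζ => mul_right_cancel₀ hζ.1 ?_)
    linear_combination hUV.eq₂ ζ hζ.2 + (h.dirac hc hDo hD hζ.2).1

end IsDiracPotential

end Potential

/-! ### The energy -/

section Energy

variable {M : Type*} [TopologicalSpace M] [ChartedSpace ℂ M] {f : M → Nil}

/-- The density `U V / e^{2α}` of the energy with respect to the area measure, expressed through
the mean curvature and the third component of the normal. -/
def energyDensity (f : M → Nil) (p : M) : ℂ :=
  (meanCurvature f p : ℂ) ^ 2 / 4 - (normalThirdAt f p : ℂ) ^ 2 / 16 +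
    I / 4 * (meanCurvature f p * normalThirdAt f p)

variable [IsManifold 𝓘(ℂ, ℂ) ω M]

namespace IsConformalImmersion

theorem energyDensity_eq (hf : IsConformalImmersion f) (p : M) :
    energyDensity f p =
      1 / 4 * (meanCurvature f p ^ 2 + tangentCurvature f p / 4 - 1 / 16 : ℝ) +
        I / 4 * (meanCurvature f p * normalThirdAt f p : ℝ) := by
  rw [energyDensity, hf.tangentCurvature_eq]
  push_cast
  ring

theorem continuous_energyDensity (hf : IsConformalImmersion f) : Continuous (energyDensity f) := by
  have meanCurvature := Complex.continuous_ofReal.comp hf.continuous_meanCurvature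
  have normalThird := Complex.continuous_ofReal.comp hf.continuous_normalThirdAt
  exact (((meanCurvature.pow 2).div_const 4).sub ((normalThird.pow 2).div_const 16)).add
    (continuous_const.mul (meanCurvature.mul normalThird))

theorem mul_eq_smul_energyDensity (hf : IsConformalImmersion f) {c : OpenPartialHomeomorph M ℂ}
    (hc : c ∈ IsManifold.maximalAtlas 𝓘(ℂ, ℂ) ω M) {D : Set ℂ} (hDo : IsOpen D)
    (hD : D ⊆ c.target) {ψ₁ ψ₂ U V : ℂ → ℂ} (h : IsGeneratingSpinor f c D ψ₁ ψ₂)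
    (hUV : IsDiracPotential D ψ₁ ψ₂ U V) {z : ℂ} (hz : z ∈ D) :
    U z * V z = firstForm f c 1 1 z • energyDensity f (c.symm z) := by
  have conformal := hf.isConformalParam hc
  have symm_mem := c.map_target (hD hz)
  obtain ⟨hU, hV⟩ := hUV.eq_diracPotential h conformal hDo hD hz
  rw [hU, hV, ← sq, h.diracPotential_sq conformal hD hz, energyDensity,
    hf.meanCurvature_eq hc symm_mem, hf.normalThirdAt_eq hc symm_mem, c.right_inv (hD hz),
    Complex.real_smul]

variable [CompactSpace M] [MeasurableSpace M]

theorem nonempty_spinorRepresentation [OpensMeasurableSpace M] (hf : IsConformalImmersion f) :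
    Nonempty (SpinorRepresentation f) := by
  have conformal := hf.isConformalParam_chartAt
  choose D hD hDo mem_D ψ₁ ψ₂ spinor using fun p =>
    (conformal p).exists_isGeneratingSpinor (mem_chart_target ℂ p)
  have isOpen_domain (p : M) := (chartAt ℂ p).isOpen_inter_preimage (hDo p)
  obtain ⟨n, x, P, measurable, disjoint, cover, subset⟩ := exists_fin_measurable_partition
    (fun p => (chartAt ℂ p).source ∩ chartAt ℂ p ⁻¹' D p)
    (fun p => (isOpen_domain p).mem_nhds ⟨mem_chart_source ℂ p, mem_D p⟩) isOpen_domain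
  exact ⟨{
    n := n
    piece := P
    measurable_piece := measurable
    disjoint_piece := disjoint
    cover := cover
    param i := chartAt ℂ (x i)
    param_mem i := IsManifold.chart_mem_maximalAtlas (x i)
    piece_subset i := (subset i).trans Set.inter_subset_left
    dom i := D (x i)
    isOpen_dom i := hDo (x i)
    dom_subset i := hD (x i)
    image_subset i := Set.image_subset_iff.2 ((subset i).trans Set.inter_subset_right)
    ψ₁ i := ψ₁ (x i)
    ψ₂ i := ψ₂ (x i)
    U i := diracPotential f (chartAt ℂ (x i)) (ψ₁ (x i)) (ψ₂ (x i))
    V i := diracPotential f (chartAt ℂ (x i)) (ψ₁ (x i)) (ψ₂ (x i))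
    spinor i := spinor (x i)
    dirac i := (spinor (x i)).isDiracPotential (conformal (x i)) (hDo (x i)) (hD (x i)) }⟩

variable [BorelSpace M]

theorem integrable_energyDensity (hf : IsConformalImmersion f) :
    Integrable (energyDensity f) (areaMeasure f) :=
  hf.integrable_of_continuous hf.continuous_energyDensity

theorem integrable_curvature (hf : IsConformalImmersion f) :
    Integrable (fun p => meanCurvature f p ^ 2 + tangentCurvature f p / 4 - 1 / 16)
      (areaMeasure f) := by
  refine hf.integrable_of_continuous ?_
  simp only [hf.tangentCurvature_eq]
  exact ((hf.continuous_meanCurvature.pow 2).add ((continuous_const.sub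
    (hf.continuous_normalThirdAt.pow 2)).div_const 4)).sub continuous_const

theorem integral_energyDensity [T2Space M] (hf : IsConformalImmersion f) :
    ∫ p, energyDensity f p ∂areaMeasure f = (((1 / 4 : ℝ) *
      ∫ p, (meanCurvature f p ^ 2 + tangentCurvature f p / 4 - 1 / 16)
        ∂areaMeasure f : ℝ) : ℂ) := by
  have integrable_mul :=
    hf.integrable_of_continuous (hf.continuous_meanCurvature.mul hf.continuous_normalThirdAt)
  simp only [hf.energyDensity_eq]
  rw [integral_add (hf.integrable_curvature.ofReal.const_mul _)
      (integrable_mul.ofReal.const_mul _),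
    integral_const_mul, integral_const_mul, integral_complex_ofReal, integral_complex_ofReal,
    hf.integral_meanCurvature_mul_normalThirdAt, Complex.ofReal_zero, mul_zero, add_zero]
  push_cast
  rfl

end IsConformalImmersion

namespace SpinorRepresentation

variable [MeasurableSpace M]

theorem eqOn_smul_energyDensity (S : SpinorRepresentation f) (hf : IsConformalImmersion f)
    (i : Fin S.n) :
    Set.EqOn (fun z => S.U i z * S.V i z)
      (fun z => firstForm f (S.param i) 1 1 z • energyDensity f ((S.param i).symm z))
      (S.param i '' S.piece i) := fun _ hz =>
  hf.mul_eq_smul_energyDensity (S.param_mem i) (S.isOpen_dom i) (S.dom_subset i) (S.spinor i)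
    (S.dirac i) (S.image_subset i hz)

variable [CompactSpace M] [BorelSpace M]

theorem isIntegrable (S : SpinorRepresentation f) (hf : IsConformalImmersion f) :
    S.IsIntegrable := fun i =>
  (integrableOn_congr_fun (S.eqOn_smul_energyDensity hf i)
    (measurableSet_image_of_subset_source (S.measurable_piece i) (S.piece_subset i))).2
    ((hf.integrableOn_areaMeasure_iff (S.param_mem i) (S.measurable_piece i) (S.piece_subset i)
      hf.integrable_energyDensity.aestronglyMeasurable).1 hf.integrable_energyDensity.integrableOn)

theorem energy_eq (S : SpinorRepresentation f) (hf : IsConformalImmersion f) :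
    S.energy = ∫ p, energyDensity f p ∂areaMeasure f := by
  rw [← setIntegral_univ, ← S.cover, integral_iUnion_fintype S.measurable_piece S.disjoint_piece
    fun _ => hf.integrable_energyDensity.integrableOn, energy]
  refine Finset.sum_congr rfl fun i _ => ?_
  rw [setIntegral_congr_fun
      (measurableSet_image_of_subset_source (S.measurable_piece i) (S.piece_subset i))
      (S.eqOn_smul_energyDensity hf i),
    hf.setIntegral_areaMeasure (S.param_mem i) (S.measurable_piece i) (S.piece_subset i)
      hf.integrable_energyDensity.aestronglyMeasurable]

end SpinorRepresentation

end Energy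

end Nil

end

theorem mainTheorem9 {M : Type*} [TopologicalSpace M] [T2Space M] [CompactSpace M]
    [ChartedSpace ℂ M] [IsManifold 𝓘(ℂ, ℂ) ω M] [MeasurableSpace M] [BorelSpace M]
    (f : M → Nil) (hf : Nil.IsConformalImmersion f) :
    Nonempty (Nil.SpinorRepresentation f) ∧
    Integrable (fun p => Nil.meanCurvature f p ^ 2 + Nil.tangentCurvature f p / 4 - 1 / 16)
      (Nil.areaMeasure f) ∧
    ∀ S : Nil.SpinorRepresentation f, S.IsIntegrable ∧
      S.energy = (((1 / 4 : ℝ) *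
        ∫ p, (Nil.meanCurvature f p ^ 2 + Nil.tangentCurvature f p / 4 - 1 / 16)
          ∂(Nil.areaMeasure f) : ℝ) : ℂ) :=
  ⟨hf.nonempty_spinorRepresentation, hf.integrable_curvature, fun S =>
    ⟨S.isIntegrable hf, (S.energy_eq hf).trans hf.integral_energyDensity⟩⟩
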